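/- **Theorem 5.5.** Let $\kappa\ge 0$ and let $\nu$ be a measure on $(0,\infty)$ with $\int_0^\infty (1\wedge z)\,\nu(dz)<\infty$, and assume that $\kappa>0$ or $\nu((0,\infty))=\infty$. Put $w(s)=\nu([s,\infty))$ for $s>0$, $$\partial^w_t f(t)=\frac{d}{dt}\int_0^t w(s)\,\bigl(f(t-s)-f(0)\bigr)\,ds ,\qquad \phi(\lambda)=\kappa\lambda+\int_0^\infty(1-e^{-\lambda z})\,\nu(dz).$$ On a probability space let $S=(S_t)_{t\ge0}$ be a subordinator with drift $\kappa$ and Lévy measure $\nu$, that is, a non-negative càdlàg process with $S_0=0$, stationary independent increments and $E[e^{-\lambda S_t}]=e^{-t\phi(\lambda)}$ for $\lambda>0$, $t\ge 0$. Let $L_t=\inf\{r\ge0: S_r>t\}$, and let $B$ be a standard one-dimensional Brownian motion independent of $S$. Let $\sigma>0$ and $K>0$, let $Y_t=Y_0\exp(\sigma B_t-\tfrac12\sigma^2t)$ be geometric Brownian motion, and write $E_x$ for the expectation when $Y_0=x$. Consider the time-fractional PDE $$(\kappa\partial_t+\partial^w_t)u(t,x)=\tfrac12\sigma^2x^2\,\partial_x^2u(t,x)\quad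 (x>0,\ t>0),\qquad u(0,x)=(x-K)^+\quad (x>0).\tag{1}$$ A function $u(t,x)$ is called a *solution* of (1) if there is $\lambda_0\ge0$ such that for every $\lambda>\lambda_0$ the Laplace transform $\bar u(\lambda,x)=\int_0^\infty e^{-\lambda t}u(t,x)\,dt$ exists as an absolutely convergent integral for all $x>0$, has at most linear growth in $x$, i.e. $|\bar u(\lambda,x)|\le C_\lambda(1+x)$ for all $x>0$, and $\bar u(\lambda,\cdot)$ is a weak solution on $(0,\infty)$ of the Laplace-transformed equation $$\tfrac12\sigma^2x^2\,\partial_x^2\bar u(\lambda,x)-\phi(\lambda)\,\bar u(\lambda,x)+\frac{\phi(\lambda)}{\lambda}(x-K)^+=0,\tag{2}$$ meaning that $\bar u(\lambda,\cdot)$ is locally integrable on $(0,\infty)$ and, for every $\eta\in C_c^\infty((0,\infty))$, $$\int_0^\infty\Bigl(\tfrac12\sigma^2\,\bar u(\lambda,x)\,(x^2\eta(x))''-\phi(\lambda)\,\bar u(\lambda,x)\,\eta(x)+\tfrac{\phi(\lambda)}{\lambda}(x-K)^+\eta(x)\Bigr)dx=0 .$$ Then (1) has a unique solution, and it is given by $$u(t,x)=E_x\bigl[(Y_{L_t}-K)^+\bigr].$$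 More precisely: for all $t\ge0$ and $x>0$ the random variable $(Y_{L_t}-K)^+$ is integrable when $Y_0=x$; $u$ is a solution of (1), is continuous on $[0,\infty)\times(0,\infty)$ and satisfies $u(0,x)=(x-K)^+$ for all $x>0$. If $v$ is any solution of (1), then for almost every $x>0$ one has $v(t,x)=u(t,x)$ for almost every $t>0$. If in addition $\bar v(\lambda,\cdot)$ is continuous on $(0,\infty)$ for all sufficiently large $\lambda$, then for every $x>0$ one has $v(t,x)=u(t,x)$ for almost every $t>0$; and if $v$ is continuous on $(0,\infty)\times(0,\infty)$, then $v(t,x)=u(t,x)$ for all $t>0$ and $x>0$. -/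

import Mathlib

open MeasureTheory ProbabilityTheory Set Filter Topology
open scoped NNReal ENNReal

noncomputable section

namespace TimeFractionalBS

/-- A Lévy measure of a subordinator: a measure on `(0, ∞)` with `∫ (1 ∧ z) ν(dz) < ∞`. -/
structure IsLevyMeasure (ν : Measure ℝ) : Prop where
  null_Iic : ν (Iic 0) = 0
  lintegral_lt_top : ∫⁻ z in Ioi (0 : ℝ), ENNReal.ofReal (min 1 z) ∂ν < ∞

/-- The Laplace exponent `φ(l) = κ l + ∫_{(0,∞)} (1 - e^{-l z}) ν(dz)`. -/
def laplaceExponent (κ : ℝ) (ν : Measure ℝ) (l : ℝ) : ℝ :=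
  κ * l + ∫ z in Ioi (0 : ℝ), (1 - Real.exp (-l * z)) ∂ν

/-- `S` is a subordinator with drift `κ` and Lévy measure `ν`: a non-negative càdlàg process
started at `0` with stationary independent increments and `E[e^{-l S_t}] = e^{-t φ(l)}`. -/
structure IsSubordinator {Ω : Type*} [MeasurableSpace Ω] (κ : ℝ) (ν : Measure ℝ)
    (S : ℝ≥0 → Ω → ℝ) (P : Measure Ω) : Prop where
  measurable : ∀ t, Measurable (S t)
  zero : ∀ᵐ ω ∂P, S 0 ω = 0
  nonneg : ∀ᵐ ω ∂P, ∀ t, 0 ≤ S t ω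
  cadlag : ∀ᵐ ω ∂P, ∀ t, ContinuousWithinAt (fun r => S r ω) (Ici t) t ∧
    ∃ y : ℝ, Tendsto (fun r => S r ω) (𝓝[<] t) (𝓝 y)
  indepIncrements : HasIndepIncrements S P
  stationaryIncrements : ∀ s t,
    IdentDistrib (fun ω => S (s + t) ω - S s ω) (S t) P P
  laplace : ∀ (t : ℝ≥0) (l : ℝ), 0 < l →
    ∫ ω, Real.exp (-l * S t ω) ∂P = Real.exp (-(t : ℝ) * laplaceExponent κ ν l)

/-- The inverse `L_t = inf {r ≥ 0 : S_r > t}`. -/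
def inverseSubordinator {Ω : Type*} (S : ℝ≥0 → Ω → ℝ) (t : ℝ) (ω : Ω) : ℝ≥0 :=
  sInf {r : ℝ≥0 | t < S r ω}

/-- Geometric Brownian motion `Y_s = x exp(σ B_s - σ² s / 2)` started at `x`. -/
def geometricBM {Ω : Type*} (σ : ℝ) (B : ℝ≥0 → Ω → ℝ) (x : ℝ) (s : ℝ≥0) (ω : Ω) : ℝ :=
  x * Real.exp (σ * B s ω - σ ^ 2 / 2 * (s : ℝ))

/-- The payoff `(x - K)⁺` of the call option. -/
def callPayoff (K x : ℝ) : ℝ := max (x - K) 0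

/-- The function `u(t, x) = E_x[(Y_{L_t} - K)⁺]`. -/
def callValue {Ω : Type*} [MeasurableSpace Ω] (P : Measure Ω) (S B : ℝ≥0 → Ω → ℝ)
    (σ K t x : ℝ) : ℝ :=
  ∫ ω, callPayoff K (geometricBM σ B x (inverseSubordinator S t ω) ω) ∂P

/-- The Laplace transform in time, `∫₀^∞ e^{-l t} u(t, x) dt`. -/
def timeLaplace (u : ℝ → ℝ → ℝ) (l x : ℝ) : ℝ :=
  ∫ t in Ioi (0 : ℝ), Real.exp (-l * t) * u t x

/-- `f` is a weak (distributional) solution on `(0, ∞)` of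
`(σ² / 2) x² f'' - c f + g = 0`. -/
structure IsWeakSolution (σ c : ℝ) (g f : ℝ → ℝ) : Prop where
  locallyIntegrable : LocallyIntegrableOn f (Ioi 0)
  weak_eq : ∀ η : ℝ → ℝ, ContDiff ℝ (⊤ : ℕ∞) η → HasCompactSupport η → tsupport η ⊆ Ioi 0 →
    ∫ x in Ioi (0 : ℝ),
      (σ ^ 2 / 2 * f x * iteratedDeriv 2 (fun y => y ^ 2 * η y) x
        - c * f x * η x + g x * η x) = 0

/-- `u` solves `(κ ∂_t + ∂^w_t) u = (σ² / 2) x² ∂_x² u` on `(0, ∞) × (0, ∞)`, with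
`u(0, x) = ψ(x)` and `w(s) = ν([s, ∞))`, in the sense of Laplace transforms: for all large `l`
the transform exists for every `x > 0`, grows at most linearly in `x`, and is a weak solution of
the transformed equation `(σ² / 2) x² f'' - φ(l) f + (φ(l) / l) ψ = 0` on `(0, ∞)`. -/
def IsLaplaceSolution (κ : ℝ) (ν : Measure ℝ) (σ : ℝ) (ψ : ℝ → ℝ) (u : ℝ → ℝ → ℝ) : Prop :=
  ∃ l₀ : ℝ, 0 ≤ l₀ ∧ ∀ l, l₀ < l →
    (∀ x, 0 < x → IntegrableOn (fun t => Real.exp (-l * t) * u t x) (Ioi 0)) ∧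
    (∃ C : ℝ, ∀ x, 0 < x → |timeLaplace u l x| ≤ C * (1 + x)) ∧
    IsWeakSolution σ (laplaceExponent κ ν l)
      (fun x => laplaceExponent κ ν l / l * ψ x) (timeLaplace u l)

end TimeFractionalBS

end

/-!
In the logarithmic price `w = log x` the transformed equation has constant coefficients. The
difference of two of its weak solutions, mollified, is a classical solution of
`(σ² / 2) (G'' - G') = φ(l) G`, whose exponents are `> 1` and `< 0`; growth at most linear in `e^w`
excludes both, so the difference vanishes.

For existence, the inverse subordinator at an independent exponential time of rate `l` is itself
exponential of rate `φ(l)`, because its tail at `r` is `E[e^{-l S_r}]`. At that random time `r`,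
`σ B_r - σ² r / 2` has characteristic function `c / (c + (σ² / 2) (ξ² + i ξ))` with `c = φ(l)`, so
Fourier inversion shows that averaging over its law inverts the formal adjoint of the transformed
equation. Injectivity of the Laplace transform then carries uniqueness from the transforms to the
solutions.
-/

noncomputable section

namespace TimeFractionalBS

/-! ### The equation in logarithmic coordinates -/

/-- The formal adjoint `a (∂² + ∂) - c` of the Black–Scholes operator `a (∂² - ∂) - c` in the
logarithmic price `w = log x`, applied to a test function. -/
def logAdjoint (a c : ℝ) (θ : ℝ → ℝ) (w : ℝ) : ℝ :=
  a * (deriv (deriv θ) w + deriv θ w) - c * θ w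

lemma continuous_logAdjoint {θ : ℝ → ℝ} (hθ : ContDiff ℝ (⊤ : ℕ∞) θ) (a c : ℝ) :
    Continuous (logAdjoint a c θ) := by
  have hθ' : ContDiff ℝ (⊤ : ℕ∞) (deriv θ) := (contDiff_infty_iff_deriv.1 hθ).2
  exact ((hθ'.continuous_deriv (by simp)).add hθ'.continuous).const_mul a |>.sub
    (hθ.continuous.const_mul c)

lemma hasCompactSupport_logAdjoint {θ : ℝ → ℝ} (hc : HasCompactSupport θ) (a c : ℝ) :
    HasCompactSupport (logAdjoint a c θ) :=
  ((hc.deriv.deriv.add hc.deriv).mul_left (f := fun _ => a)).sub (hc.mul_left (f := fun _ => c))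

lemma integral_Ioi_eq_integral_exp (F : ℝ → ℝ) :
    ∫ x in Ioi (0 : ℝ), F x = ∫ w, Real.exp w * F (Real.exp w) := by
  have h := integral_image_eq_integral_abs_deriv_smul (s := univ) (f := Real.exp)
    (f' := Real.exp) MeasurableSet.univ
    (fun x _ => (Real.hasDerivAt_exp x).hasDerivWithinAt) Real.exp_injective.injOn F
  simpa [image_univ, Real.range_exp, abs_of_pos (Real.exp_pos _)] using h

lemma exp_image_subset_Ioi (s : Set ℝ) : Real.exp '' s ⊆ Ioi 0 :=
  image_subset_iff.2 fun w _ => Real.exp_pos w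

lemma locallyIntegrable_comp_exp {f : ℝ → ℝ} (hf : LocallyIntegrableOn f (Ioi 0)) :
    LocallyIntegrable (fun w => f (Real.exp w)) := by
  rw [locallyIntegrable_iff]
  intro K hK
  have himage : IntegrableOn f (Real.exp '' K) :=
    hf.integrableOn_compact_subset (exp_image_subset_Ioi K) (hK.image Real.continuous_exp)
  rw [integrableOn_image_iff_integrableOn_abs_deriv_smul hK.measurableSet
    (fun x _ => (Real.hasDerivAt_exp x).hasDerivWithinAt) Real.exp_injective.injOn] at himage
  have hcancel : IntegrableOn (fun w => Real.exp (-w) * (|Real.exp w| • f (Real.exp w))) K :=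
    himage.continuousOn_mul (by fun_prop) hK
  refine hcancel.congr_fun (fun w _ => ?_) hK.measurableSet
  simp [← mul_assoc, ← Real.exp_add]

lemma ae_restrict_Ioi_of_ae_comp_exp {p : ℝ → Prop} (h : ∀ᵐ w : ℝ, p (Real.exp w)) :
    ∀ᵐ x ∂(volume.restrict (Ioi (0 : ℝ))), p x := by
  have hnull : volume (Real.exp '' {w | ¬ p (Real.exp w)}) = 0 :=
    addHaar_image_eq_zero_of_differentiableOn_of_addHaar_eq_zero volume
      (Real.differentiable_exp.differentiableOn) (ae_iff.1 h)
  rw [ae_restrict_iff' measurableSet_Ioi]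
  refine measure_mono_null (fun x hx => ?_) hnull
  obtain ⟨hx0, hx⟩ := Classical.not_imp.1 hx
  exact ⟨Real.log x, by rwa [mem_ofPred_eq, Real.exp_log hx0], Real.exp_log hx0⟩

lemma exp_mul_deriv_exp {N : ℝ → ℝ} (hN : Differentiable ℝ N) (w : ℝ) :
    Real.exp w * deriv N (Real.exp w) = deriv (fun v => N (Real.exp v)) w := by
  rw [mul_comm]
  exact ((hN _).hasDerivAt.comp w (Real.hasDerivAt_exp w)).deriv.symm

lemma exp_mul_iteratedDeriv_two_exp {N θ : ℝ → ℝ} (hN : ContDiff ℝ (⊤ : ℕ∞) N)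
    (hθ : ContDiff ℝ (⊤ : ℕ∞) θ) (h : ∀ w, N (Real.exp w) = Real.exp w * θ w) (w : ℝ) :
    Real.exp w * iteratedDeriv 2 N (Real.exp w) = deriv (deriv θ) w + deriv θ w := by
  have hθ' : ContDiff ℝ (⊤ : ℕ∞) (deriv θ) := (contDiff_infty_iff_deriv.1 hθ).2
  have hN' : ContDiff ℝ (⊤ : ℕ∞) (deriv N) := (contDiff_infty_iff_deriv.1 hN).2
  have hdθ : ∀ v, HasDerivAt θ (deriv θ v) v := fun v =>
    (hθ.differentiable (by simp) v).hasDerivAt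
  have hdN : ∀ v, deriv N (Real.exp v) = θ v + deriv θ v := fun v => by
    have h1 := exp_mul_deriv_exp (hN.differentiable (by simp)) v
    rw [funext h, ((Real.hasDerivAt_exp v).fun_mul (hdθ v)).deriv, ← mul_add] at h1
    exact mul_left_cancel₀ (Real.exp_pos v).ne' h1
  have hddθ : HasDerivAt (fun v => θ v + deriv θ v) (deriv θ w + deriv (deriv θ) w) w :=
    (hdθ w).add (hθ'.differentiable (by simp) w).hasDerivAt
  rw [iteratedDeriv_succ, iteratedDeriv_one, exp_mul_deriv_exp (hN'.differentiable (by simp)),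
    funext hdN, hddθ.deriv, add_comm]

lemma contDiff_exp_mul_comp_exp {η : ℝ → ℝ} (hη : ContDiff ℝ (⊤ : ℕ∞) η) :
    ContDiff ℝ (⊤ : ℕ∞) (fun w => Real.exp w * η (Real.exp w)) :=
  Real.contDiff_exp.mul (hη.comp Real.contDiff_exp)

lemma hasCompactSupport_exp_mul_comp_exp {η : ℝ → ℝ} (hc : HasCompactSupport η)
    (hs : tsupport η ⊆ Ioi 0) : HasCompactSupport (fun w => Real.exp w * η (Real.exp w)) := by
  have hK : IsCompact (Real.log '' tsupport η) :=
    IsCompact.image_of_continuousOn hc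
      (Real.continuousOn_log.mono fun x hx => (hs hx).ne')
  refine HasCompactSupport.intro hK fun w hw => ?_
  have : Real.exp w ∉ tsupport η := fun h => hw ⟨_, h, Real.log_exp w⟩
  simp [image_eq_zero_of_notMem_tsupport this]

/-- The test function on `(0, ∞)` corresponding to the test function `θ` of the logarithmic price,
that is, the function `η` supported in `(0, ∞)` with `e^w η(e^w) = θ(w)`. -/
def expTest (θ : ℝ → ℝ) (x : ℝ) : ℝ := if 0 < x then x⁻¹ * θ (Real.log x) else 0

lemma exp_mul_expTest_exp (θ : ℝ → ℝ) (w : ℝ) :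
    Real.exp w * expTest θ (Real.exp w) = θ w := by
  simp [expTest, Real.exp_pos]

lemma expTest_eq_zero {θ : ℝ → ℝ} {x : ℝ} (hx : x ∉ Real.exp '' tsupport θ) :
    expTest θ x = 0 := by
  unfold expTest
  split_ifs with h
  · have : Real.log x ∉ tsupport θ := fun h' => hx ⟨_, h', Real.exp_log h⟩
    simp [image_eq_zero_of_notMem_tsupport this]
  · rfl

lemma hasCompactSupport_expTest {θ : ℝ → ℝ} (hc : HasCompactSupport θ) :
    HasCompactSupport (expTest θ) :=
  HasCompactSupport.intro (IsCompact.image hc Real.continuous_exp) fun _ => expTest_eq_zero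

lemma tsupport_expTest_subset {θ : ℝ → ℝ} (hc : HasCompactSupport θ) :
    tsupport (expTest θ) ⊆ Real.exp '' tsupport θ :=
  closure_minimal (fun _ hx => by_contra fun h => hx (expTest_eq_zero h))
    (IsCompact.image hc Real.continuous_exp).isClosed

lemma contDiff_expTest {θ : ℝ → ℝ} (hθ : ContDiff ℝ (⊤ : ℕ∞) θ) (hc : HasCompactSupport θ) :
    ContDiff ℝ (⊤ : ℕ∞) (expTest θ) := by
  refine contDiff_iff_contDiffAt.2 fun x => ?_
  by_cases hx : 0 < x
  · have h1 : ContDiffAt ℝ (⊤ : ℕ∞) (fun x => x⁻¹ * θ (Real.log x)) x :=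
      (contDiffAt_inv ℝ hx.ne').mul (hθ.contDiffAt.comp x (Real.contDiffAt_log.2 hx.ne'))
    refine h1.congr_of_eventuallyEq ?_
    filter_upwards [lt_mem_nhds hx] with y hy
    simp [expTest, hy]
  · have hx' : x ∉ tsupport (expTest θ) := fun h =>
      hx (exp_image_subset_Ioi _ (tsupport_expTest_subset hc h))
    exact contDiffAt_const.congr_of_eventuallyEq (notMem_tsupport_iff_eventuallyEq.1 hx')

lemma integral_weak_eq_integral_logAdjoint {σ c : ℝ} {f g η θ : ℝ → ℝ}
    (hη : ContDiff ℝ (⊤ : ℕ∞) η) (hθ : ContDiff ℝ (⊤ : ℕ∞) θ)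
    (h : ∀ w, Real.exp w * η (Real.exp w) = θ w) :
    ∫ x in Ioi (0 : ℝ), (σ ^ 2 / 2 * f x * iteratedDeriv 2 (fun y => y ^ 2 * η y) x
        - c * f x * η x + g x * η x) =
      ∫ w, (f (Real.exp w) * logAdjoint (σ ^ 2 / 2) c θ w + g (Real.exp w) * θ w) := by
  rw [integral_Ioi_eq_integral_exp]
  congr 1 with w
  have h2 := exp_mul_iteratedDeriv_two_exp (N := fun y => y ^ 2 * η y)
    ((contDiff_id.pow 2).mul hη) hθ (fun w => by rw [← h w]; ring) w
  rw [logAdjoint, ← h2, ← h w]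
  ring

lemma isWeakSolution_iff_integral_logAdjoint {σ c : ℝ} {f g : ℝ → ℝ} :
    IsWeakSolution σ c g f ↔ LocallyIntegrableOn f (Ioi 0) ∧
      ∀ θ : ℝ → ℝ, ContDiff ℝ (⊤ : ℕ∞) θ → HasCompactSupport θ →
        ∫ w, (f (Real.exp w) * logAdjoint (σ ^ 2 / 2) c θ w + g (Real.exp w) * θ w) = 0 := by
  refine ⟨fun hf => ⟨hf.locallyIntegrable, fun θ hθ hc => ?_⟩,
    fun hf => ⟨hf.1, fun η hη hc hs => ?_⟩⟩
  · rw [← integral_weak_eq_integral_logAdjoint (contDiff_expTest hθ hc) hθ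
      (exp_mul_expTest_exp θ)]
    exact hf.weak_eq _ (contDiff_expTest hθ hc) (hasCompactSupport_expTest hc)
      ((tsupport_expTest_subset hc).trans (exp_image_subset_Ioi _))
  · rw [integral_weak_eq_integral_logAdjoint hη (contDiff_exp_mul_comp_exp hη) (fun _ => rfl)]
    exact hf.2 _ (contDiff_exp_mul_comp_exp hη) (hasCompactSupport_exp_mul_comp_exp hc hs)

/-! ### Uniqueness of weak solutions of at most linear growth -/

lemma exists_characteristic_exponents {a c : ℝ} (ha : 0 < a) (hc : 0 < c) :
    ∃ p q : ℝ, 1 < p ∧ q < 0 ∧ p + q = 1 ∧ a * (p * q) = -c := by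
  have hr : √(1 + 4 * (c / a)) ^ 2 = 1 + 4 * (c / a) := Real.sq_sqrt (by positivity)
  have hr1 : 1 < √(1 + 4 * (c / a)) :=
    Real.lt_sqrt_of_sq_lt (by linarith [div_pos hc ha])
  refine ⟨(1 + √(1 + 4 * (c / a))) / 2, (1 - √(1 + 4 * (c / a))) / 2, by linarith, by linarith,
    by ring, ?_⟩
  calc _ = a * (1 - √(1 + 4 * (c / a)) ^ 2) / 4 := by ring
    _ = -c := by rw [hr]; field_simp; ring

lemma exists_sub_mul_eq_mul_exp {p q : ℝ} {G G₁ G₂ : ℝ → ℝ} (h1 : ∀ y, HasDerivAt G (G₁ y) y)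
    (h2 : ∀ y, HasDerivAt G₁ (G₂ y) y) (hode : ∀ y, G₂ y = (p + q) * G₁ y - p * q * G y) :
    ∃ A, ∀ y, G₁ y - q * G y = A * Real.exp (p * y) := by
  have hd : ∀ y, HasDerivAt (fun y => (G₁ y - q * G y) * Real.exp (-(p * y))) 0 y := by
    intro y
    convert! ((h2 y).sub ((h1 y).const_mul q)).mul
      (((hasDerivAt_id y).const_mul p).neg.exp) using 1
    simp only [Pi.sub_apply, Pi.neg_apply, id, hode]
    ring
  refine ⟨G₁ 0 - q * G 0, fun y => ?_⟩
  have := is_const_of_deriv_eq_zero (fun y => (hd y).differentiableAt) (fun y => (hd y).deriv) y 0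
  simp only [mul_zero, neg_zero, Real.exp_zero, mul_one] at this
  rw [← this, mul_assoc, ← Real.exp_add, neg_add_cancel, Real.exp_zero, mul_one]

lemma tendsto_exp_mul_atTop_zero {k : ℝ} (hk : k < 0) :
    Tendsto (fun y => Real.exp (k * y)) atTop (𝓝 0) :=
  Real.tendsto_exp_atBot.comp (tendsto_id.const_mul_atTop_of_neg hk)

lemma tendsto_exp_mul_atBot_zero {k : ℝ} (hk : 0 < k) :
    Tendsto (fun y => Real.exp (k * y)) atBot (𝓝 0) :=
  Real.tendsto_exp_atBot.comp (tendsto_id.const_mul_atBot hk)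

lemma tendsto_exp_mul_mul_zero {l : Filter ℝ} {k C : ℝ} {G : ℝ → ℝ}
    (hb : ∀ y, |G y| ≤ C * (1 + Real.exp y))
    (h0 : Tendsto (fun y => Real.exp (k * y)) l (𝓝 0))
    (h1 : Tendsto (fun y => Real.exp ((k + 1) * y)) l (𝓝 0)) :
    Tendsto (fun y => Real.exp (k * y) * G y) l (𝓝 0) := by
  have hbound : Tendsto (fun y => C * (Real.exp (k * y) + Real.exp ((k + 1) * y))) l (𝓝 0) := by
    simpa using (h0.add h1).const_mul C
  refine squeeze_zero_norm (fun y => ?_) hbound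
  calc ‖Real.exp (k * y) * G y‖ = Real.exp (k * y) * |G y| := by
        rw [norm_mul, Real.norm_eq_abs, Real.abs_exp, Real.norm_eq_abs]
    _ ≤ Real.exp (k * y) * (C * (1 + Real.exp y)) := by gcongr; exact hb y
    _ = C * (Real.exp (k * y) + Real.exp ((k + 1) * y)) := by rw [add_mul, Real.exp_add]; ring_nf

lemma eq_zero_of_ode_of_growth {p q C : ℝ} (hp : 1 < p) (hq : q < 0) {G G₁ G₂ : ℝ → ℝ}
    (h1 : ∀ y, HasDerivAt G (G₁ y) y) (h2 : ∀ y, HasDerivAt G₁ (G₂ y) y)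
    (hode : ∀ y, G₂ y = (p + q) * G₁ y - p * q * G y)
    (hb : ∀ y, |G y| ≤ C * (1 + Real.exp y)) (y : ℝ) : G y = 0 := by
  obtain ⟨A, hA⟩ := exists_sub_mul_eq_mul_exp h1 h2 hode
  obtain ⟨A', hA'⟩ := exists_sub_mul_eq_mul_exp (p := q) (q := p) h1 h2
    fun y => by rw [hode, add_comm, mul_comm q p]
  have hG : ∀ y, (p - q) * G y = A * Real.exp (p * y) - A' * Real.exp (q * y) := fun y => by
    rw [← hA, ← hA']
    ring
  have hA0 : A = 0 := by
    have hlim : Tendsto (fun y => (p - q) * (Real.exp (-p * y) * G y) +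
        A' * Real.exp ((q - p) * y)) atTop (𝓝 0) := by
      simpa using ((tendsto_exp_mul_mul_zero (k := -p) hb (tendsto_exp_mul_atTop_zero (by linarith))
        (tendsto_exp_mul_atTop_zero (by linarith))).const_mul (p - q)).add
        ((tendsto_exp_mul_atTop_zero (by linarith : q - p < 0)).const_mul A')
    refine tendsto_nhds_unique (tendsto_const_nhds.congr fun y => ?_) hlim
    rw [mul_left_comm, hG, sub_mul, sub_eq_add_neg (q * y), Real.exp_add, neg_mul, Real.exp_neg]
    field_simp
    ring
  have hA'0 : A' = 0 := by
    have hlim : Tendsto (fun y => -(p - q) * (Real.exp (-q * y) * G y)) atBot (𝓝 0) := by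
      simpa using (tendsto_exp_mul_mul_zero (k := -q) hb (tendsto_exp_mul_atBot_zero (by linarith))
        (tendsto_exp_mul_atBot_zero (by linarith))).const_mul (-(p - q))
    refine tendsto_nhds_unique (tendsto_const_nhds.congr fun y => ?_) hlim
    rw [neg_mul, mul_left_comm, hG, hA0, neg_mul, Real.exp_neg]
    field_simp
    ring
  have := hG y
  rw [hA0, hA'0, zero_mul, zero_mul, sub_zero] at this
  exact (mul_eq_zero.1 this).resolve_left (by linarith)

section Mollification

variable {D χ : ℝ → ℝ}

lemma integrable_mul_comp_sub_left (hD : LocallyIntegrable D) (hχ : Continuous χ)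
    (hχc : HasCompactSupport χ) (y : ℝ) : Integrable (fun t => D t * χ (y - t)) :=
  hD.integrable_smul_right_of_hasCompactSupport (hχ.comp (by fun_prop))
    (hχc.comp_homeomorph (Homeomorph.subLeft y))

lemma hasDerivAt_integral_mul_comp_sub_left (hD : LocallyIntegrable D)
    (hχ : ContDiff ℝ (⊤ : ℕ∞) χ) (hχc : HasCompactSupport χ) (y : ℝ) :
    HasDerivAt (fun y => ∫ t, D t * χ (y - t)) (∫ t, D t * deriv χ (y - t)) y :=
  hχc.hasDerivAt_convolution_right (ContinuousLinearMap.mul ℝ ℝ) hD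
    (hχ.of_le (by exact_mod_cast le_top)) y

lemma logAdjoint_comp_sub_left (a c : ℝ) (χ : ℝ → ℝ) (y t : ℝ) :
    logAdjoint a c (fun s => χ (y - s)) t =
      a * (deriv (deriv χ) (y - t) - deriv χ (y - t)) - c * χ (y - t) := by
  have hd (f : ℝ → ℝ) : deriv (fun s => f (y - s)) = fun s => -deriv f (y - s) :=
    funext fun s => deriv_comp_const_sub ..
  rw [logAdjoint, hd, deriv.fun_neg, hd]
  ring

lemma integral_mul_logAdjoint_comp_sub_left (hD : LocallyIntegrable D)
    (hχ : ContDiff ℝ (⊤ : ℕ∞) χ) (hχc : HasCompactSupport χ) (a c y : ℝ) :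
    ∫ t, D t * logAdjoint a c (fun s => χ (y - s)) t =
      a * (∫ t, D t * deriv (deriv χ) (y - t)) - a * (∫ t, D t * deriv χ (y - t))
        - c * ∫ t, D t * χ (y - t) := by
  have hχ' : ContDiff ℝ (⊤ : ℕ∞) (deriv χ) := (contDiff_infty_iff_deriv.1 hχ).2
  have i0 := (integrable_mul_comp_sub_left hD hχ.continuous hχc y).const_mul c
  have i1 := (integrable_mul_comp_sub_left hD hχ'.continuous hχc.deriv y).const_mul a
  have i2 := (integrable_mul_comp_sub_left hD (hχ'.continuous_deriv (by simp))
    hχc.deriv.deriv y).const_mul a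
  simp only [← integral_const_mul]
  rw [← integral_sub i2 i1, ← integral_sub (by exact i2.sub i1) i0]
  congr 1 with t
  rw [logAdjoint_comp_sub_left]
  ring

lemma abs_integral_mul_comp_sub_left_le {C : ℝ} (hb : ∀ w, |D w| ≤ C * (1 + Real.exp w))
    (hχ : Continuous χ) (hχc : HasCompactSupport χ) (y : ℝ) :
    |∫ t, D t * χ (y - t)| ≤ (C * ∫ s, (1 + Real.exp (-s)) * |χ s|) * (1 + Real.exp y) := by
  have hC : 0 ≤ C :=
    nonneg_of_mul_nonneg_left ((abs_nonneg _).trans (hb 0)) (by positivity)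
  have hint : Integrable (fun s => (1 + Real.exp (-s)) * |χ s|) :=
    ((by fun_prop : Continuous fun s : ℝ => 1 + Real.exp (-s)).mul
      hχ.abs).integrable_of_hasCompactSupport
      ((hχc.comp_left (g := fun x => |x|) abs_zero).mul_left (f := fun s => 1 + Real.exp (-s)))
  calc |∫ t, D t * χ (y - t)| = ‖∫ s, D (y - s) * χ s‖ := by
        rw [← integral_sub_left_eq_self _ volume y, Real.norm_eq_abs]
        simp only [sub_sub_cancel]
    _ ≤ ∫ s, C * (1 + Real.exp y) * ((1 + Real.exp (-s)) * |χ s|) := by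
        refine norm_integral_le_of_norm_le (hint.const_mul _) (ae_of_all _ fun s => ?_)
        rw [Real.norm_eq_abs, abs_mul, ← mul_assoc, mul_assoc C]
        refine mul_le_mul_of_nonneg_right ((hb _).trans ?_) (abs_nonneg _)
        refine mul_le_mul_of_nonneg_left ?_ hC
        rw [sub_eq_add_neg, Real.exp_add]
        nlinarith [Real.exp_pos y, Real.exp_pos (-s)]
    _ = _ := by rw [integral_const_mul]; ring

/-- The mollification `D * χ` is a classical solution of `a (G'' - G') = c G` with the growth of
`D`, and the exponents of this equation lie outside `[0, 1]`. -/
lemma integral_mul_comp_sub_left_eq_zero {a c C : ℝ} (ha : 0 < a) (hc : 0 < c)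
    (hD : LocallyIntegrable D) (hb : ∀ w, |D w| ≤ C * (1 + Real.exp w))
    (h : ∀ θ : ℝ → ℝ, ContDiff ℝ (⊤ : ℕ∞) θ → HasCompactSupport θ →
      ∫ w, D w * logAdjoint a c θ w = 0)
    (hχ : ContDiff ℝ (⊤ : ℕ∞) χ) (hχc : HasCompactSupport χ) (y : ℝ) :
    ∫ t, D t * χ (y - t) = 0 := by
  obtain ⟨p, q, hp, hq, hsum, hprod⟩ := exists_characteristic_exponents ha hc
  have hχ' : ContDiff ℝ (⊤ : ℕ∞) (deriv χ) := (contDiff_infty_iff_deriv.1 hχ).2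
  refine eq_zero_of_ode_of_growth hp hq (hasDerivAt_integral_mul_comp_sub_left hD hχ hχc)
    (hasDerivAt_integral_mul_comp_sub_left hD hχ' hχc.deriv) (fun y => ?_)
    (abs_integral_mul_comp_sub_left_le hb hχ.continuous hχc) y
  have heq := h _ (hχ.comp (contDiff_const.sub contDiff_id))
    (hχc.comp_homeomorph (Homeomorph.subLeft y))
  have hexpand := integral_mul_logAdjoint_comp_sub_left hD hχ hχc a c y
  refine mul_left_cancel₀ ha.ne' ?_
  rw [hsum, one_mul, mul_sub, ← mul_assoc, hprod]
  linarith [hexpand.symm.trans heq]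

lemma ae_eq_zero_of_integral_mul_logAdjoint_eq_zero {a c C : ℝ} (ha : 0 < a) (hc : 0 < c)
    (hD : LocallyIntegrable D) (hb : ∀ w, |D w| ≤ C * (1 + Real.exp w))
    (h : ∀ θ : ℝ → ℝ, ContDiff ℝ (⊤ : ℕ∞) θ → HasCompactSupport θ →
      ∫ w, D w * logAdjoint a c θ w = 0) :
    ∀ᵐ w, D w = 0 := by
  refine ae_eq_zero_of_integral_contDiff_smul_eq_zero hD fun χ hχ hχc => ?_
  have := integral_mul_comp_sub_left_eq_zero ha hc hD hb h (hχ.comp contDiff_neg)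
    (hχc.comp_homeomorph (Homeomorph.neg ℝ)) 0
  simpa [mul_comm] using this

end Mollification

lemma IsWeakSolution.integral_sub_mul_logAdjoint_eq_zero {σ c : ℝ} {g f₁ f₂ : ℝ → ℝ}
    (hg : LocallyIntegrableOn g (Ioi 0)) (h₁ : IsWeakSolution σ c g f₁)
    (h₂ : IsWeakSolution σ c g f₂) {θ : ℝ → ℝ} (hθ : ContDiff ℝ (⊤ : ℕ∞) θ)
    (hθc : HasCompactSupport θ) :
    ∫ w, (f₁ (Real.exp w) - f₂ (Real.exp w)) * logAdjoint (σ ^ 2 / 2) c θ w = 0 := by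
  have hint {f : ℝ → ℝ} (hf : LocallyIntegrableOn f (Ioi 0)) :
      Integrable (fun w => f (Real.exp w) * logAdjoint (σ ^ 2 / 2) c θ w) :=
    (locallyIntegrable_comp_exp hf).integrable_smul_right_of_hasCompactSupport
      (continuous_logAdjoint hθ _ _) (hasCompactSupport_logAdjoint hθc _ _)
  have hgint : Integrable (fun w => g (Real.exp w) * θ w) :=
    (locallyIntegrable_comp_exp hg).integrable_smul_right_of_hasCompactSupport hθ.continuous hθc
  obtain ⟨l₁, w₁⟩ := isWeakSolution_iff_integral_logAdjoint.1 h₁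
  obtain ⟨l₂, w₂⟩ := isWeakSolution_iff_integral_logAdjoint.1 h₂
  have e₁ := w₁ θ hθ hθc
  have e₂ := w₂ θ hθ hθc
  rw [integral_add (hint l₁) hgint] at e₁
  rw [integral_add (hint l₂) hgint] at e₂
  simp only [sub_mul]
  rw [integral_sub (hint l₁) (hint l₂)]
  linarith

lemma IsWeakSolution.ae_eq {σ c C₁ C₂ : ℝ} (hσ : σ ≠ 0) (hc : 0 < c) {g f₁ f₂ : ℝ → ℝ}
    (hg : LocallyIntegrableOn g (Ioi 0))
    (h₁ : IsWeakSolution σ c g f₁) (h₂ : IsWeakSolution σ c g f₂)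
    (hb₁ : ∀ x, 0 < x → |f₁ x| ≤ C₁ * (1 + x)) (hb₂ : ∀ x, 0 < x → |f₂ x| ≤ C₂ * (1 + x)) :
    ∀ᵐ x ∂(volume.restrict (Ioi (0 : ℝ))), f₁ x = f₂ x := by
  have hae := ae_eq_zero_of_integral_mul_logAdjoint_eq_zero (a := σ ^ 2 / 2) (C := C₁ + C₂)
    (by positivity) hc ((locallyIntegrable_comp_exp h₁.locallyIntegrable).sub
      (locallyIntegrable_comp_exp h₂.locallyIntegrable))
    (fun w => (abs_sub _ _).trans (by
      linarith [hb₁ _ (Real.exp_pos w), hb₂ _ (Real.exp_pos w)]))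
    fun θ => h₁.integral_sub_mul_logAdjoint_eq_zero hg h₂
  exact ae_restrict_Ioi_of_ae_comp_exp (hae.mono fun w => sub_eq_zero.1)

/-! ### Injectivity of the Laplace transform -/

section LaplaceInjectivity

variable {f g : ℝ → ℝ}

lemma exp_neg_mem_Icc {t : ℝ} (ht : 0 < t) : Real.exp (-t) ∈ Icc (0 : ℝ) 1 :=
  ⟨(Real.exp_pos _).le, Real.exp_le_one_iff.2 (by linarith)⟩

lemma integrableOn_comp_exp_neg_mul (hg : IntegrableOn g (Ioi 0)) {q : ℝ → ℝ}
    (hq : Continuous q) : IntegrableOn (fun t => q (Real.exp (-t)) * g t) (Ioi 0) := by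
  obtain ⟨M, hM⟩ := (isCompact_Icc (a := (0 : ℝ)) (b := 1)).exists_bound_of_continuousOn
    hq.continuousOn
  exact hg.bdd_mul (c := M) (hq.comp (by fun_prop)).aestronglyMeasurable
    (ae_restrict_of_forall_mem measurableSet_Ioi fun t ht => hM _ (exp_neg_mem_Icc ht))

lemma integral_eval_exp_neg_mul_eq_zero (hg : IntegrableOn g (Ioi 0))
    (h : ∀ k : ℕ, ∫ t in Ioi (0 : ℝ), Real.exp (-k * t) * g t = 0) (p : Polynomial ℝ) :
    ∫ t in Ioi (0 : ℝ), p.eval (Real.exp (-t)) * g t = 0 := by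
  induction p using Polynomial.induction_on' with
  | add p q hp hq =>
    simp only [Polynomial.eval_add, add_mul]
    rw [integral_add (integrableOn_comp_exp_neg_mul hg p.continuous)
      (integrableOn_comp_exp_neg_mul hg q.continuous), hp, hq, add_zero]
  | monomial n a =>
    have hpow : ∀ t : ℝ, Real.exp (-t) ^ n = Real.exp (-n * t) := fun t => by
      rw [← Real.exp_nat_mul]; ring_nf
    simp only [Polynomial.eval_monomial, mul_assoc, hpow]
    rw [integral_const_mul, h n, mul_zero]

lemma integral_comp_exp_neg_mul_eq_zero (hg : IntegrableOn g (Ioi 0))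
    (h : ∀ k : ℕ, ∫ t in Ioi (0 : ℝ), Real.exp (-k * t) * g t = 0) {q : ℝ → ℝ}
    (hq : Continuous q) : ∫ t in Ioi (0 : ℝ), q (Real.exp (-t)) * g t = 0 := by
  have hle : ∀ ε > 0, |∫ t in Ioi (0 : ℝ), q (Real.exp (-t)) * g t| ≤
      ε * ∫ t in Ioi (0 : ℝ), |g t| := by
    intro ε hε
    obtain ⟨p, hp⟩ := exists_polynomial_near_of_continuousOn 0 1 q hq.continuousOn ε hε
    calc |∫ t in Ioi (0 : ℝ), q (Real.exp (-t)) * g t|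
        = ‖∫ t in Ioi (0 : ℝ), (q (Real.exp (-t)) - p.eval (Real.exp (-t))) * g t‖ := by
          simp only [sub_mul]
          rw [integral_sub (integrableOn_comp_exp_neg_mul hg hq)
            (integrableOn_comp_exp_neg_mul hg p.continuous),
            integral_eval_exp_neg_mul_eq_zero hg h, sub_zero, Real.norm_eq_abs]
      _ ≤ ∫ t in Ioi (0 : ℝ), ε * |g t| := by
          refine norm_integral_le_of_norm_le (hg.abs.const_mul _)
            (ae_restrict_of_forall_mem measurableSet_Ioi fun t ht => ?_)
          rw [norm_mul, Real.norm_eq_abs, Real.norm_eq_abs, abs_sub_comm]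
          exact mul_le_mul_of_nonneg_right (hp _ (exp_neg_mem_Icc ht)).le (abs_nonneg _)
      _ = ε * ∫ t in Ioi (0 : ℝ), |g t| := integral_const_mul ..
  have hlim : Tendsto (fun ε => ε * ∫ t in Ioi (0 : ℝ), |g t|) (𝓝[>] 0) (𝓝 0) := by
    simpa using (tendsto_id.mul_const _).mono_left (nhdsWithin_le_nhds (a := (0 : ℝ)))
  exact abs_nonpos_iff.1 (ge_of_tendsto hlim (eventually_mem_nhdsWithin.mono hle))

lemma ae_eq_zero_of_integral_exp_nat_mul_eq_zero (hg : IntegrableOn g (Ioi 0))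
    (h : ∀ k : ℕ, ∫ t in Ioi (0 : ℝ), Real.exp (-k * t) * g t = 0) :
    ∀ᵐ t ∂(volume.restrict (Ioi (0 : ℝ))), g t = 0 := by
  refine (ae_restrict_iff' measurableSet_Ioi).2 ?_
  refine isOpen_Ioi.ae_eq_zero_of_integral_contDiff_smul_eq_zero hg.locallyIntegrableOn
    fun η hη hηc hηs => ?_
  have hq : Continuous fun s => s * expTest (fun w => η (-w)) s :=
    continuous_id.mul (contDiff_expTest (hη.comp contDiff_neg)
      (hηc.comp_homeomorph (Homeomorph.neg ℝ))).continuous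
  have hzero := integral_comp_exp_neg_mul_eq_zero hg h hq
  simp only [exp_mul_expTest_exp, neg_neg] at hzero
  rw [← hzero]
  refine (setIntegral_eq_integral_of_forall_compl_eq_zero fun t ht => ?_).symm
  rw [image_eq_zero_of_notMem_tsupport fun h => ht (hηs h), zero_smul]

lemma ae_eq_of_integral_exp_mul_eq {l₀ : ℝ}
    (hf : ∀ l, l₀ < l → IntegrableOn (fun t => Real.exp (-l * t) * f t) (Ioi 0))
    (hg : ∀ l, l₀ < l → IntegrableOn (fun t => Real.exp (-l * t) * g t) (Ioi 0))
    (h : ∀ n : ℕ, l₀ < n → ∫ t in Ioi (0 : ℝ), Real.exp (-n * t) * f t =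
      ∫ t in Ioi (0 : ℝ), Real.exp (-n * t) * g t) :
    ∀ᵐ t ∂(volume.restrict (Ioi (0 : ℝ))), f t = g t := by
  obtain ⟨m, hm⟩ := exists_nat_gt l₀
  have hzero := ae_eq_zero_of_integral_exp_nat_mul_eq_zero ((hf m hm).sub (hg m hm)) fun k => ?_
  · filter_upwards [hzero] with t ht
    exact mul_left_cancel₀ (Real.exp_ne_zero _) (sub_eq_zero.1 ht)
  · have hk : l₀ < ((k + m : ℕ) : ℝ) := hm.trans_le (by exact_mod_cast Nat.le_add_left m k)
    have hsplit : ∀ t y : ℝ, Real.exp (-k * t) * (Real.exp (-m * t) * y) =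
        Real.exp (-(k + m : ℕ) * t) * y := fun t y => by
      rw [← mul_assoc, ← Real.exp_add]
      push_cast
      ring_nf
    simp only [Pi.sub_apply, mul_sub, hsplit]
    rw [integral_sub (hf _ hk) (hg _ hk), h _ hk, sub_self]

end LaplaceInjectivity

/-! ### Fourier inversion against a measure with rational characteristic function -/

section Fourier

open scoped FourierTransform SchwartzMap
open SchwartzMap (derivCLM)

variable {μ : Measure ℝ} {a c : ℝ} {θ : ℝ → ℝ}

lemma schwartz_eq_integral_fourier (R : 𝓢(ℝ, ℂ)) (x : ℝ) :
    R x = ∫ ξ, Complex.exp (↑(2 * Real.pi * (ξ * x)) * Complex.I) * 𝓕 R ξ := by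
  have h1 := congrFun (R.continuous.fourierInv_fourier_eq R.integrable (𝓕 R).integrable) x
  rw [← SchwartzMap.fourier_coe, Real.fourierInv_eq'] at h1
  rw [← h1]
  simp [mul_comm]

lemma integral_comp_sub_left_eq_integral_fourier_mul_charFun [IsFiniteMeasure μ] (R : 𝓢(ℝ, ℂ))
    (y : ℝ) :
    ∫ z, R (y - z) ∂μ = ∫ ξ, Complex.exp (↑(2 * Real.pi * (ξ * y)) * Complex.I) *
      (𝓕 R ξ * charFun μ (-(2 * Real.pi * ξ))) := by
  have hR : ∀ z, R (y - z) = ∫ ξ, (Complex.exp (↑(2 * Real.pi * (ξ * y)) * Complex.I) *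
      Complex.exp (((-(2 * Real.pi * ξ) : ℝ) : ℂ) * z * Complex.I)) * 𝓕 R ξ := by
    intro z
    rw [schwartz_eq_integral_fourier]
    congr 1 with ξ
    rw [← Complex.exp_add]
    congr 2
    push_cast
    ring
  simp only [hR]
  rw [integral_integral_swap]
  · congr 1 with ξ
    rw [integral_mul_const, integral_const_mul, charFun_apply_real]
    ring
  · refine ((𝓕 R).integrable.comp_snd μ).bdd_mul (c := 1)
      (Continuous.aestronglyMeasurable (by fun_prop)) (ae_of_all _ fun p => ?_)
    rw [norm_mul, Complex.norm_exp_ofReal_mul_I, ← Complex.ofReal_mul,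
      Complex.norm_exp_ofReal_mul_I, one_mul]

lemma fourier_derivCLM (T : 𝓢(ℝ, ℂ)) (ξ : ℝ) :
    𝓕 (derivCLM ℂ ℂ T) ξ = 2 * Real.pi * Complex.I * ξ * 𝓕 T ξ :=
  congrFun (Real.fourier_deriv T.integrable T.differentiable (derivCLM ℂ ℂ T).integrable) ξ

lemma fourier_logAdjoint (a c : ℂ) (T : 𝓢(ℝ, ℂ)) (ξ : ℝ) :
    𝓕 (a • (derivCLM ℂ ℂ (derivCLM ℂ ℂ T) + derivCLM ℂ ℂ T) - c • T) ξ =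
      -(c + a * ((-(2 * Real.pi * ξ) : ℝ) ^ 2 + (-(2 * Real.pi * ξ) : ℝ) * Complex.I)) *
        𝓕 T ξ := by
  rw [sub_eq_add_neg, FourierTransform.fourier_add, FourierTransform.fourier_neg,
    FourierTransform.fourier_smul, FourierTransform.fourier_smul, FourierTransform.fourier_add]
  simp only [add_apply, neg_apply, smul_apply, smul_eq_mul, fourier_derivCLM]
  push_cast
  linear_combination (4 * a * Real.pi ^ 2 * ξ ^ 2 * 𝓕 T ξ) * Complex.I_sq

lemma integral_logAdjoint_schwartz_comp_sub_left [IsFiniteMeasure μ] {a c : ℂ}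
    (hμ : ∀ ξ : ℝ, charFun μ ξ * (c + a * (ξ ^ 2 + ξ * Complex.I)) = c)
    (T : 𝓢(ℝ, ℂ)) (y : ℝ) :
    ∫ z, (a • (derivCLM ℂ ℂ (derivCLM ℂ ℂ T) + derivCLM ℂ ℂ T) - c • T) (y - z) ∂μ =
      -(c * T y) := by
  rw [integral_comp_sub_left_eq_integral_fourier_mul_charFun, schwartz_eq_integral_fourier T y,
    ← neg_mul, ← integral_const_mul]
  congr 1 with ξ
  rw [fourier_logAdjoint]
  linear_combination (-Complex.exp (↑(2 * Real.pi * (ξ * y)) * Complex.I) * 𝓕 T ξ) *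
    hμ (-(2 * Real.pi * ξ))

lemma deriv_ofReal_comp {f : ℝ → ℝ} (hf : Differentiable ℝ f) :
    deriv (fun w => (f w : ℂ)) = fun w => ((deriv f w : ℝ) : ℂ) :=
  funext fun w => (hf w).hasDerivAt.ofReal_comp.deriv

lemma integral_logAdjoint_comp_sub_left [IsFiniteMeasure μ]
    (hμ : ∀ ξ : ℝ, charFun μ ξ * (c + a * (ξ ^ 2 + ξ * Complex.I)) = c)
    (hθ : ContDiff ℝ (⊤ : ℕ∞) θ) (hc : HasCompactSupport θ) (y : ℝ) :
    ∫ z, logAdjoint a c θ (y - z) ∂μ = -(c * θ y) := by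
  have hθ' : ContDiff ℝ (⊤ : ℕ∞) (deriv θ) := (contDiff_infty_iff_deriv.1 hθ).2
  set T : 𝓢(ℝ, ℂ) := HasCompactSupport.toSchwartzMap (f := fun w => (θ w : ℂ))
    (hc.comp_left (g := fun x : ℝ => (x : ℂ)) Complex.ofReal_zero)
    (Complex.ofRealCLM.contDiff.comp hθ)
  have hT : ⇑T = fun w => (θ w : ℂ) := rfl
  have hT' : ⇑(derivCLM ℂ ℂ T) = fun w => ((deriv θ w : ℝ) : ℂ) :=
    deriv_ofReal_comp (hθ.differentiable (by simp))
  have hT'' : ⇑(derivCLM ℂ ℂ (derivCLM ℂ ℂ T)) = fun w => ((deriv (deriv θ) w : ℝ) : ℂ) :=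
    (congrArg deriv hT').trans (deriv_ofReal_comp (hθ'.differentiable (by simp)))
  have hlog : ∀ w, ((a : ℂ) • (derivCLM ℂ ℂ (derivCLM ℂ ℂ T) + derivCLM ℂ ℂ T) - (c : ℂ) • T) w =
      (logAdjoint a c θ w : ℂ) := fun w => by
    simp only [sub_apply, add_apply, smul_apply, smul_eq_mul, hT, hT', hT'', logAdjoint]
    push_cast
    rfl
  have key := integral_logAdjoint_schwartz_comp_sub_left hμ T y
  simp only [hlog, hT] at key
  rw [integral_complex_ofReal] at key
  exact_mod_cast key

lemma integral_integral_comp_add_mul [SFinite μ] {H ρ : ℝ → ℝ} (hH : Measurable H)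
    (hρ : Measurable ρ)
    (hint : Integrable (fun p : ℝ × ℝ => H (p.1 + p.2) * ρ p.2) (μ.prod volume)) :
    ∫ w, (∫ z, H (z + w) ∂μ) * ρ w = ∫ y, H y * ∫ z, ρ (y - z) ∂μ := by
  have hint' : Integrable (fun p : ℝ × ℝ => H p.2 * ρ (p.2 - p.1)) (μ.prod volume) := by
    rw [← (measurePreserving_prod_add μ volume).integrable_comp
      (Measurable.aestronglyMeasurable (by fun_prop))]
    refine hint.congr (ae_of_all _ fun p => ?_)
    simp
  calc ∫ w, (∫ z, H (z + w) ∂μ) * ρ w = ∫ z, (∫ w, H (z + w) * ρ w) ∂μ := by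
        simp only [← integral_mul_const]
        exact (integral_integral_swap (f := fun z w => H (z + w) * ρ w) hint).symm
    _ = ∫ z, (∫ y, H y * ρ (y - z)) ∂μ := by
        congr 1 with z
        rw [← integral_add_left_eq_self (fun y => H y * ρ (y - z)) z]
        simp only [add_sub_cancel_left]
    _ = ∫ y, H y * ∫ z, ρ (y - z) ∂μ := by
        simp only [← integral_const_mul]
        exact integral_integral_swap (f := fun z y => H y * ρ (y - z)) hint'

lemma integrable_comp_exp_add_mul [IsFiniteMeasure μ] (hexp : Integrable Real.exp μ) {A : ℝ}
    {ψ ρ : ℝ → ℝ} (hψ : Continuous ψ) (hA : ∀ x, |ψ x| ≤ A * (1 + |x|)) (hρ : Continuous ρ)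
    (hρc : HasCompactSupport ρ) :
    Integrable (fun p : ℝ × ℝ => ψ (Real.exp (p.1 + p.2)) * ρ p.2) (μ.prod volume) := by
  have hρint : Integrable ρ := hρ.integrable_of_hasCompactSupport hρc
  have hexpρ : Integrable (fun w => Real.exp w * ρ w) :=
    (Real.continuous_exp.mul hρ).integrable_of_hasCompactSupport hρc.mul_left
  have hdom : Integrable (fun p : ℝ × ℝ => A * (‖ρ p.2‖ + ‖Real.exp p.1 * (Real.exp p.2 * ρ p.2)‖))
      (μ.prod volume) :=
    ((hρint.comp_snd μ).norm.add (hexp.mul_prod hexpρ).norm).const_mul A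
  refine hdom.mono' (Continuous.aestronglyMeasurable (by fun_prop)) (ae_of_all _ fun p => ?_)
  calc ‖ψ (Real.exp (p.1 + p.2)) * ρ p.2‖
      ≤ A * (1 + Real.exp (p.1 + p.2)) * ‖ρ p.2‖ := by
        rw [norm_mul]
        gcongr
        simpa [abs_of_pos (Real.exp_pos _)] using hA (Real.exp (p.1 + p.2))
    _ = _ := by
        simp only [norm_mul, Real.norm_eq_abs, Real.abs_exp, Real.exp_add]
        ring

lemma abs_comp_mul_exp_le {ψ : ℝ → ℝ} {A : ℝ} (hA : ∀ x, |ψ x| ≤ A * (1 + |x|)) (x y : ℝ) :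
    |ψ (x * Real.exp y)| ≤ A * (1 + |x| * Real.exp y) := by
  simpa only [abs_mul, Real.abs_exp] using hA (x * Real.exp y)

lemma continuous_integral_comp_mul_exp [IsFiniteMeasure μ] (hexp : Integrable Real.exp μ) {A : ℝ}
    {ψ : ℝ → ℝ} (hψ : Continuous ψ) (hA : ∀ x, |ψ x| ≤ A * (1 + |x|)) :
    Continuous fun x => ∫ z, ψ (x * Real.exp z) ∂μ := by
  have hA₀ : 0 ≤ A := by simpa using (abs_nonneg _).trans (hA 0)
  refine continuous_iff_continuousAt.2 fun x => ?_
  have hdom : Integrable (fun z => A * (1 + (|x| + 1) * Real.exp z)) μ :=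
    ((integrable_const 1).add (hexp.const_mul _)).const_mul A
  refine continuousAt_of_dominated (Eventually.of_forall fun y =>
    Continuous.aestronglyMeasurable (by fun_prop)) ?_ hdom (ae_of_all _ fun z => by fun_prop)
  filter_upwards [(continuous_abs.tendsto x).eventually_le_const (lt_add_one _)] with y hy
  refine ae_of_all _ fun z => (abs_comp_mul_exp_le hA y z).trans ?_
  gcongr

lemma isWeakSolution_integral_comp_mul_exp [IsFiniteMeasure μ] {σ A : ℝ}
    (hμ : ∀ ξ : ℝ, charFun μ ξ * (c + (σ ^ 2 / 2 : ℝ) * (ξ ^ 2 + ξ * Complex.I)) = c)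
    (hexp : Integrable Real.exp μ) {ψ : ℝ → ℝ} (hψ : Continuous ψ)
    (hA : ∀ x, |ψ x| ≤ A * (1 + |x|)) :
    IsWeakSolution σ c (fun x => c * ψ x) (fun x => ∫ z, ψ (x * Real.exp z) ∂μ) := by
  have hloc : LocallyIntegrableOn (fun x => ∫ z, ψ (x * Real.exp z) ∂μ) (Ioi 0) :=
    (continuous_integral_comp_mul_exp hexp hψ hA).continuousOn.locallyIntegrableOn
      measurableSet_Ioi
  refine isWeakSolution_iff_integral_logAdjoint.2 ⟨hloc, fun θ hθ hc => ?_⟩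
  have hρ := continuous_logAdjoint hθ (σ ^ 2 / 2) c
  have hρc := hasCompactSupport_logAdjoint hc (σ ^ 2 / 2) c
  have hψe : Continuous fun w => ψ (Real.exp w) := hψ.comp Real.continuous_exp
  have hfint : Integrable fun w =>
      (∫ z, ψ (Real.exp w * Real.exp z) ∂μ) * logAdjoint (σ ^ 2 / 2) c θ w :=
    (locallyIntegrable_comp_exp hloc).integrable_smul_right_of_hasCompactSupport hρ hρc
  have hgint : Integrable fun w => c * ψ (Real.exp w) * θ w :=
    ((hψe.const_mul c).mul hθ.continuous).integrable_of_hasCompactSupport hc.mul_left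
  have hdual : ∫ w, (∫ z, ψ (Real.exp w * Real.exp z) ∂μ) * logAdjoint (σ ^ 2 / 2) c θ w =
      -∫ w, c * ψ (Real.exp w) * θ w := by
    simp only [fun w z => (by rw [← Real.exp_add, add_comm] :
      Real.exp w * Real.exp z = Real.exp (z + w))]
    rw [integral_integral_comp_add_mul (H := fun y => ψ (Real.exp y)) hψe.measurable hρ.measurable
      (integrable_comp_exp_add_mul hexp hψ hA hρ hρc), ← integral_neg]
    congr 1 with y
    rw [integral_logAdjoint_comp_sub_left hμ hθ hc]
    ring
  rw [integral_add hfint hgint, hdual, neg_add_cancel]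

end Fourier

lemma IsWeakSolution.const_mul {σ c : ℝ} {g f : ℝ → ℝ} (hf : IsWeakSolution σ c g f) (b : ℝ) :
    IsWeakSolution σ c (fun x => b * g x) (fun x => b * f x) := by
  refine ⟨hf.locallyIntegrable.smul b, fun η hη hηc hηs => ?_⟩
  refine Eq.trans ?_ ((integral_const_mul b _).trans (mul_eq_zero_of_right b
    (hf.weak_eq η hη hηc hηs)))
  congr 1 with x
  ring

/-! ### Geometric Brownian motion at an exponential time -/

lemma integral_expMeasure {E : Type*} [NormedAddCommGroup E] [NormedSpace ℝ E] {c : ℝ}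
    (hc : 0 < c) (f : ℝ → E) :
    ∫ r, f r ∂(expMeasure c) = ∫ r in Ioi (0 : ℝ), (c * Real.exp (-(c * r))) • f r := by
  have hdens : expMeasure c = volume.withDensity (exponentialPDF c) := rfl
  have hm : Measurable (exponentialPDF c) := (measurable_exponentialPDFReal c).ennreal_ofReal
  rw [hdens, integral_withDensity_eq_integral_toReal_smul hm
    (ae_of_all _ fun x => ENNReal.ofReal_lt_top), ← integral_Ici_eq_integral_Ioi,
    ← integral_indicator measurableSet_Ici]
  congr 1 with r
  by_cases hr : 0 ≤ r
  · rw [indicator_of_mem (by exact hr), exponentialPDF_of_nonneg hr,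
      ENNReal.toReal_ofReal (by positivity)]
  · rw [indicator_of_notMem (by exact hr), exponentialPDF_of_neg (not_le.1 hr),
      ENNReal.toReal_zero, zero_smul]

lemma ae_nonneg_expMeasure (c : ℝ) : ∀ᵐ r ∂(expMeasure c), 0 ≤ r := by
  have hdens : expMeasure c = volume.withDensity (exponentialPDF c) := rfl
  have hneg : expMeasure c (Iio 0) = 0 := by
    rw [hdens, withDensity_apply _ measurableSet_Iio]
    exact lintegral_exponentialPDF_of_nonpos le_rfl
  simp only [ae_iff, not_le]
  exact hneg

lemma expMeasure_Ioi {c : ℝ} (hc : 0 < c) {x : ℝ} (hx : 0 ≤ x) :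
    expMeasure c (Ioi x) = ENNReal.ofReal (Real.exp (-(c * x))) := by
  have := isProbabilityMeasure_expMeasure hc
  have hcdf := cdf_expMeasure_eq hc x
  rw [if_pos hx, cdf_eq_real] at hcdf
  rw [← compl_Iic, ← ofReal_measureReal, probReal_compl_eq_one_sub measurableSet_Iic, hcdf,
    sub_sub_cancel]

lemma integral_cexp_neg_mul_expMeasure {c : ℝ} (hc : 0 < c) {q : ℂ} (hq : 0 ≤ q.re) :
    ∫ r, Complex.exp (-q * r) ∂(expMeasure c) = c / (c + q) := by
  have hre : (-(c + q)).re < 0 := by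
    simp only [Complex.neg_re, Complex.add_re, Complex.ofReal_re]
    linarith
  have hdens : ∀ r : ℝ, (c * Real.exp (-(c * r))) • Complex.exp (-q * r) =
      c * Complex.exp (-(c + q) * r) := fun r => by
    rw [Complex.real_smul]
    push_cast
    rw [mul_assoc, ← Complex.exp_add]
    ring_nf
  rw [integral_expMeasure hc]
  simp only [hdens]
  rw [integral_const_mul, integral_exp_mul_complex_Ioi hre, Complex.ofReal_zero, mul_zero,
    Complex.exp_zero, neg_div_neg_eq, mul_one_div]

/-- The exponent `σ √r z - σ² r / 2` of geometric Brownian motion at time `r`, with the Brownian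
motion written as `√r z` for a standard normal variable `z`. -/
def gbmExponent (σ r z : ℝ) : ℝ := σ * (√r * z) - σ ^ 2 / 2 * r

lemma continuous_gbmExponent (σ : ℝ) : Continuous fun p : ℝ × ℝ => gbmExponent σ p.1 p.2 := by
  unfold gbmExponent
  fun_prop

lemma exp_gbmExponent (σ r z : ℝ) :
    Real.exp (gbmExponent σ r z) = Real.exp (σ * √r * z) * Real.exp (-(σ ^ 2 / 2 * r)) := by
  rw [← Real.exp_add, gbmExponent]
  ring_nf

lemma integrable_exp_gbmExponent (σ r : ℝ) :
    Integrable (fun z => Real.exp (gbmExponent σ r z)) (gaussianReal 0 1) := by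
  simp only [exp_gbmExponent]
  exact (integrable_exp_mul_gaussianReal _).mul_const _

lemma integral_exp_gbmExponent (σ : ℝ) {r : ℝ} (hr : 0 ≤ r) :
    ∫ z, Real.exp (gbmExponent σ r z) ∂(gaussianReal 0 1) = 1 := by
  have hmgf : ∫ z, Real.exp (σ * √r * z) ∂(gaussianReal 0 1) = Real.exp ((σ * √r) ^ 2 / 2) := by
    simpa [mgf] using congrFun (mgf_id_gaussianReal (μ := 0) (v := 1)) (σ * √r)
  simp only [exp_gbmExponent]
  rw [integral_mul_const, hmgf, ← Real.exp_add, mul_pow, Real.sq_sqrt hr, Real.exp_eq_one_iff]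
  ring

lemma integral_cexp_gbmExponent (σ ξ : ℝ) {r : ℝ} (hr : 0 ≤ r) :
    ∫ z, Complex.exp (ξ * gbmExponent σ r z * Complex.I) ∂(gaussianReal 0 1) =
      Complex.exp (-((σ ^ 2 / 2 : ℝ) * (ξ ^ 2 + ξ * Complex.I)) * r) := by
  have hsplit : ∀ z : ℝ, Complex.exp (ξ * gbmExponent σ r z * Complex.I) =
      Complex.exp (((ξ * σ * √r : ℝ) : ℂ) * z * Complex.I) *
        Complex.exp (-(ξ * (σ ^ 2 / 2 * r : ℝ) * Complex.I)) := fun z => by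
    rw [← Complex.exp_add, gbmExponent]
    congr 1
    push_cast
    ring
  have hsqrt : ((√r : ℝ) : ℂ) ^ 2 = r := by rw [← Complex.ofReal_pow, Real.sq_sqrt hr]
  simp only [hsplit]
  rw [integral_mul_const, ← charFun_apply_real, charFun_gaussianReal, ← Complex.exp_add]
  congr 1
  push_cast
  linear_combination (-(ξ ^ 2 * σ ^ 2 / 2 : ℂ)) * hsqrt

/-- The law of `σ B_e - σ² e / 2` at an independent exponential time `e` of rate `c`. -/
def gbmExpLaw (σ c : ℝ) : Measure ℝ :=
  ((expMeasure c).prod (gaussianReal 0 1)).map fun p => gbmExponent σ p.1 p.2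

lemma isProbabilityMeasure_gbmExpLaw (σ : ℝ) {c : ℝ} (hc : 0 < c) :
    IsProbabilityMeasure (gbmExpLaw σ c) := by
  have := isProbabilityMeasure_expMeasure hc
  exact Measure.isProbabilityMeasure_map (continuous_gbmExponent σ).aemeasurable

lemma charFun_gbmExpLaw (σ : ℝ) {c : ℝ} (hc : 0 < c) (ξ : ℝ) :
    charFun (gbmExpLaw σ c) ξ * (c + (σ ^ 2 / 2 : ℝ) * (ξ ^ 2 + ξ * Complex.I)) = c := by
  have := isProbabilityMeasure_expMeasure hc
  have hexp := continuous_gbmExponent σ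
  set q : ℂ := (σ ^ 2 / 2 : ℝ) * (ξ ^ 2 + ξ * Complex.I)
  have hq : q.re = σ ^ 2 / 2 * ξ ^ 2 := by simp [q, pow_two]
  have hq0 : 0 ≤ q.re := by rw [hq]; positivity
  have hcq : c + q ≠ 0 := fun h => by
    have hre := congrArg Complex.re h
    simp only [Complex.add_re, Complex.ofReal_re, Complex.zero_re] at hre
    linarith
  have hint : Integrable (fun p : ℝ × ℝ => Complex.exp (ξ * gbmExponent σ p.1 p.2 * Complex.I))
      ((expMeasure c).prod (gaussianReal 0 1)) := by
    refine (integrable_const (1 : ℝ)).mono' (Continuous.aestronglyMeasurable (by fun_prop))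
      (ae_of_all _ fun p => ?_)
    rw [← Complex.ofReal_mul, Complex.norm_exp_ofReal_mul_I]
  calc charFun (gbmExpLaw σ c) ξ * (c + q)
      = (∫ r, (∫ z, Complex.exp (ξ * gbmExponent σ r z * Complex.I) ∂(gaussianReal 0 1))
          ∂(expMeasure c)) * (c + q) := by
        rw [charFun_apply_real, gbmExpLaw, integral_map hexp.aemeasurable
          (Continuous.aestronglyMeasurable (by fun_prop)), integral_prod _ hint]
    _ = (∫ r, Complex.exp (-q * r) ∂(expMeasure c)) * (c + q) := by
        congr 1
        refine integral_congr_ae ?_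
        filter_upwards [ae_nonneg_expMeasure c] with r hr
        exact integral_cexp_gbmExponent σ ξ hr
    _ = c := by rw [integral_cexp_neg_mul_expMeasure hc hq0, div_mul_cancel₀ _ hcq]

section Semigroup

variable {ψ : ℝ → ℝ} {A σ : ℝ}

/-- The transition semigroup `ψ ↦ E[ψ (x exp (σ B_r - σ² r / 2))]` of geometric Brownian
motion. -/
def gbmSemigroup (ψ : ℝ → ℝ) (σ r x : ℝ) : ℝ :=
  ∫ z, ψ (x * Real.exp (gbmExponent σ r z)) ∂(gaussianReal 0 1)

lemma gbmSemigroup_zero (ψ : ℝ → ℝ) (σ x : ℝ) : gbmSemigroup ψ σ 0 x = ψ x := by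
  simp [gbmSemigroup, gbmExponent]

lemma integrable_comp_mul_exp_gbmExponent (hψ : Continuous ψ) (hA : ∀ x, |ψ x| ≤ A * (1 + |x|))
    {α : Type*} [MeasurableSpace α] {μ : Measure α} [IsFiniteMeasure μ] {τ : α → ℝ}
    (hτ : Measurable τ) (hτ₀ : ∀ᵐ a ∂μ, 0 ≤ τ a) (x : ℝ) :
    Integrable (fun p : α × ℝ => ψ (x * Real.exp (gbmExponent σ (τ p.1) p.2)))
      (μ.prod (gaussianReal 0 1)) := by
  have hm : Measurable fun p : α × ℝ => gbmExponent σ (τ p.1) p.2 :=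
    (continuous_gbmExponent σ).measurable.comp
      ((hτ.comp measurable_fst).prodMk measurable_snd)
  have hexp : Integrable (fun p : α × ℝ => Real.exp (gbmExponent σ (τ p.1) p.2))
      (μ.prod (gaussianReal 0 1)) := by
    rw [integrable_prod_iff hm.exp.aestronglyMeasurable]
    refine ⟨ae_of_all _ fun a => integrable_exp_gbmExponent σ (τ a),
      (integrable_const (1 : ℝ)).congr ?_⟩
    filter_upwards [hτ₀] with a ha
    simp only [Real.norm_eq_abs, Real.abs_exp, integral_exp_gbmExponent σ ha]
  exact (((integrable_const 1).add (hexp.const_mul |x|)).const_mul A).mono'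
    (hψ.measurable.comp (hm.exp.const_mul x)).aestronglyMeasurable
    (ae_of_all _ fun p => abs_comp_mul_exp_le hA _ _)

lemma abs_gbmSemigroup_le (hA : ∀ x, |ψ x| ≤ A * (1 + |x|)) {r : ℝ} (hr : 0 ≤ r) (x : ℝ) :
    |gbmSemigroup ψ σ r x| ≤ A * (1 + |x|) := by
  have hexp := integrable_exp_gbmExponent σ r
  have hdom : Integrable (fun z => A * (1 + |x| * Real.exp (gbmExponent σ r z)))
      (gaussianReal 0 1) :=
    ((integrable_const 1).add (hexp.const_mul |x|)).const_mul A
  calc |gbmSemigroup ψ σ r x|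
      ≤ ∫ z, A * (1 + |x| * Real.exp (gbmExponent σ r z)) ∂(gaussianReal 0 1) :=
        norm_integral_le_of_norm_le (f := fun z => ψ (x * Real.exp (gbmExponent σ r z))) hdom
          (ae_of_all _ fun z => abs_comp_mul_exp_le hA _ _)
    _ = A * (1 + |x|) := by
        rw [integral_const_mul, integral_add (integrable_const 1) (hexp.const_mul |x|),
          integral_const_mul, integral_exp_gbmExponent σ hr]
        simp

lemma integrable_gbmSemigroup (hψ : Continuous ψ) (hA : ∀ x, |ψ x| ≤ A * (1 + |x|))
    {α : Type*} [MeasurableSpace α] {μ : Measure α} [IsFiniteMeasure μ] {τ : α → ℝ}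
    (hτ : Measurable τ) (hτ₀ : ∀ᵐ a ∂μ, 0 ≤ τ a) (x : ℝ) :
    Integrable (fun a => gbmSemigroup ψ σ (τ a) x) μ :=
  (integrable_comp_mul_exp_gbmExponent hψ hA hτ hτ₀ x).integral_prod_left

lemma gbmExponent_le {σ r R : ℝ} (hR : |r| ≤ R) (z : ℝ) :
    gbmExponent σ r z ≤ |σ| * √R * |z| + σ ^ 2 / 2 * R := by
  have hsqrt : √r ≤ √R := Real.sqrt_le_sqrt ((le_abs_self r).trans hR)
  have hnoise : σ * (√r * z) ≤ |σ| * √R * |z| :=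
    calc σ * (√r * z) ≤ |σ * (√r * z)| := le_abs_self _
      _ = |σ| * √r * |z| := by rw [abs_mul, abs_mul, abs_of_nonneg (Real.sqrt_nonneg r), mul_assoc]
      _ ≤ |σ| * √R * |z| := by gcongr
  have hdrift : σ ^ 2 / 2 * -r ≤ σ ^ 2 / 2 * R := by
    gcongr
    exact (neg_le_abs r).trans hR
  unfold gbmExponent
  linarith

lemma continuous_gbmSemigroup (hψ : Continuous ψ) (hA : ∀ x, |ψ x| ≤ A * (1 + |x|)) (σ : ℝ) :
    Continuous fun p : ℝ × ℝ => gbmSemigroup ψ σ p.1 p.2 := by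
  have hA₀ : 0 ≤ A := by simpa using (abs_nonneg _).trans (hA 0)
  have hcont : Continuous fun q : (ℝ × ℝ) × ℝ =>
      ψ (q.1.2 * Real.exp (gbmExponent σ q.1.1 q.2)) :=
    hψ.comp (continuous_fst.snd.mul
      ((continuous_gbmExponent σ).comp (continuous_fst.fst.prodMk continuous_snd)).rexp)
  refine continuous_iff_continuousAt.2 fun p => ?_
  set R := |p.1| + 1
  set X := |p.2| + 1
  have hnhds : ∀ᶠ q in 𝓝 p, |q.1| ≤ R ∧ |q.2| ≤ X :=
    ((continuous_fst.abs.tendsto p).eventually_le_const (lt_add_one _)).and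
      ((continuous_snd.abs.tendsto p).eventually_le_const (lt_add_one _))
  have hbound : Integrable
      (fun z => A * (1 + X * (Real.exp (|σ| * √R * |z|) * Real.exp (σ ^ 2 / 2 * R))))
      (gaussianReal 0 1) :=
    ((integrable_const 1).add (((integrable_exp_mul_abs (integrable_exp_mul_gaussianReal _)
      (integrable_exp_mul_gaussianReal _)).mul_const _).const_mul _)).const_mul _
  refine continuousAt_of_dominated (Eventually.of_forall fun q =>
    (hcont.comp (Continuous.prodMk_right q)).aestronglyMeasurable) ?_ hbound
    (ae_of_all _ fun z => (hcont.comp (Continuous.prodMk_left z)).continuousAt)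
  filter_upwards [hnhds] with q hq
  refine ae_of_all _ fun z => (abs_comp_mul_exp_le hA _ _).trans ?_
  rw [← Real.exp_add]
  gcongr
  · exact hq.2
  · exact gbmExponent_le hq.1 z

lemma integrable_exp_gbmExpLaw (σ : ℝ) {c : ℝ} (hc : 0 < c) :
    Integrable Real.exp (gbmExpLaw σ c) := by
  have := isProbabilityMeasure_expMeasure hc
  rw [gbmExpLaw, integrable_map_measure Real.continuous_exp.aestronglyMeasurable
    (continuous_gbmExponent σ).aemeasurable]
  simpa [Function.comp_def] using integrable_comp_mul_exp_gbmExponent (ψ := id) (A := 1)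
    continuous_id (fun x => by simp) measurable_id (ae_nonneg_expMeasure c) 1

lemma integral_gbmSemigroup_expMeasure (hψ : Continuous ψ) (hA : ∀ x, |ψ x| ≤ A * (1 + |x|))
    {c : ℝ} (hc : 0 < c) (x : ℝ) :
    ∫ r, gbmSemigroup ψ σ r x ∂(expMeasure c) = ∫ z, ψ (x * Real.exp z) ∂(gbmExpLaw σ c) := by
  have := isProbabilityMeasure_expMeasure hc
  have hcont : Continuous fun z => ψ (x * Real.exp z) := by fun_prop
  rw [gbmExpLaw, integral_map (continuous_gbmExponent σ).aemeasurable hcont.aestronglyMeasurable]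
  exact (integral_prod _ (integrable_comp_mul_exp_gbmExponent hψ hA measurable_id
    (ae_nonneg_expMeasure c) x)).symm

end Semigroup

/-! ### Inverses of strictly increasing paths -/

/-- The path properties of a strictly increasing subordinator, under which the inverse path is
continuous. -/
structure IsInvertiblePath (s : ℝ≥0 → ℝ) : Prop where
  strictMono : StrictMono s
  rightCont : ∀ t, ContinuousWithinAt s (Ici t) t
  zero : s 0 = 0
  unbounded : ∀ M : ℝ, ∃ r, M < s r

/-- The right-continuous inverse `t ↦ inf {r : s r > t}` of a path; `inverseSubordinator` is its
value on the paths of the subordinator. -/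
def pathInv (s : ℝ≥0 → ℝ) (t : ℝ) : ℝ≥0 := sInf {r : ℝ≥0 | t < s r}

/-- A version of `pathInv` that only looks at the path on the rationals, and is therefore
measurable for the product σ-algebra on paths. -/
def ratPathInv (t : ℝ) (s : ℝ≥0 → ℝ) : ℝ≥0 :=
  (⨅ q : ℚ≥0, if t < s (q : ℝ≥0) then ((q : ℝ≥0) : ℝ≥0∞) else ∞).toNNReal

lemma measurable_ratPathInv : Measurable fun p : ℝ × (ℝ≥0 → ℝ) => ratPathInv p.1 p.2 :=
  ENNReal.measurable_toNNReal.comp <| Measurable.iInf fun _ =>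
    Measurable.ite (measurableSet_lt measurable_fst ((measurable_pi_apply _).comp measurable_snd))
      measurable_const measurable_const

lemma exists_nnrat_btwn {a b : ℝ≥0} (hab : a < b) : ∃ q : ℚ≥0, a < (q : ℝ≥0) ∧ (q : ℝ≥0) < b := by
  obtain ⟨q, hq₀, haq, hqb⟩ := (NNReal.lt_iff_exists_rat_btwn a b).1 hab
  lift q to ℚ≥0 using hq₀
  have hcast : Real.toNNReal ((q : ℚ) : ℝ) = (q : ℝ≥0) := by
    ext
    rw [Real.coe_toNNReal _ (Rat.cast_nonneg.2 q.coe_nonneg)]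
    exact Rat.cast_nnratCast q
  exact ⟨q, hcast ▸ haq, hcast ▸ hqb⟩

lemma le_of_lt_pathInv {s : ℝ≥0 → ℝ} {r : ℝ≥0} {t : ℝ} (h : r < pathInv s t) : s r ≤ t :=
  not_lt.1 fun hlt => h.not_ge (csInf_le (OrderBot.bddBelow _) hlt)

namespace IsInvertiblePath

variable {s : ℝ≥0 → ℝ} (hs : IsInvertiblePath s)
include hs

lemma nonneg (r : ℝ≥0) : 0 ≤ s r := hs.zero ▸ hs.strictMono.monotone zero_le

lemma pathInv_apply (r : ℝ≥0) : pathInv s (s r) = r := by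
  simp only [pathInv, hs.strictMono.lt_iff_lt]
  exact csInf_Ioi

lemma pathInv_zero : pathInv s 0 = 0 := by
  simpa only [hs.zero] using hs.pathInv_apply 0

lemma monotone_pathInv : Monotone (pathInv s) := fun _ t h =>
  csInf_le_csInf (OrderBot.bddBelow _) (hs.unbounded t) fun _ hr => h.trans_lt hr

lemma continuous_pathInv : Continuous (pathInv s) :=
  hs.monotone_pathInv.continuous_of_surjective fun r => ⟨s r, hs.pathInv_apply r⟩

lemma lt_pathInv_of_lt {r : ℝ≥0} {t : ℝ} (h : s r < t) : r < pathInv s t := by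
  have hlt : ∀ᶠ r' in 𝓝[>] r, s r' < t :=
    ((hs.rightCont r).mono Ioi_subset_Ici_self).eventually_lt_const h
  obtain ⟨r', hr't, hrr'⟩ := (hlt.and self_mem_nhdsWithin).exists
  calc r < r' := hrr'
    _ = pathInv s (s r') := (hs.pathInv_apply r').symm
    _ ≤ pathInv s t := hs.monotone_pathInv hr't.le

lemma ratPathInv_eq (t : ℝ) : ratPathInv t s = pathInv s t := by
  suffices h : (⨅ q : ℚ≥0, if t < s (q : ℝ≥0) then ((q : ℝ≥0) : ℝ≥0∞) else ∞) = pathInv s t by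
    rw [ratPathInv, h, ENNReal.toNNReal_coe]
  refine le_antisymm (le_of_forall_gt fun b hb => ?_) (le_iInf fun q => ?_)
  · obtain ⟨r, htr, hrb⟩ := ENNReal.lt_iff_exists_nnreal_btwn.1 hb
    obtain ⟨r', htr', hr'r⟩ :=
      exists_lt_of_csInf_lt (hs.unbounded t) (ENNReal.coe_lt_coe.1 htr)
    obtain ⟨q, hr'q, hqr⟩ := exists_nnrat_btwn hr'r
    refine (iInf_le _ q).trans_lt ?_
    rw [if_pos (lt_trans htr' (hs.strictMono hr'q))]
    exact (ENNReal.coe_lt_coe.2 hqr).trans hrb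
  · split_ifs with h
    · exact ENNReal.coe_le_coe.2 (csInf_le (OrderBot.bddBelow _) h)
    · exact le_top

end IsInvertiblePath

lemma frequently_nnrat_nhdsGT (a : ℝ≥0) : ∃ᶠ r in 𝓝[>] a, r ∈ range ((↑) : ℚ≥0 → ℝ≥0) := by
  refine (nhdsGT_basis a).frequently_iff.2 fun b hab => ?_
  obtain ⟨q, haq, hqb⟩ := exists_nnrat_btwn hab
  exact ⟨q, ⟨haq, hqb⟩, q, rfl⟩

lemma strictMono_of_strictMono_nnratCast {s : ℝ≥0 → ℝ} (hs : StrictMono fun q : ℚ≥0 => s q)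
    (hr : ∀ t, ContinuousWithinAt s (Ici t) t) : StrictMono s := by
  have hlim (a : ℝ≥0) : Tendsto s (𝓝[>] a) (𝓝 (s a)) := (hr a).mono Ioi_subset_Ici_self
  have hle {a : ℝ≥0} {p : ℚ≥0} (hap : a < p) : s a ≤ s p := by
    have hlt : ∀ᶠ r in 𝓝[>] a, r < (p : ℝ≥0) := (gt_mem_nhds hap).filter_mono nhdsWithin_le_nhds
    refine le_of_tendsto_of_frequently (hlim a) ?_
    refine ((frequently_nnrat_nhdsGT a).and_eventually hlt).mono ?_
    rintro _ ⟨⟨q, rfl⟩, hqp⟩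
    exact (hs (NNRat.cast_lt.1 hqp)).le
  have hge {a : ℝ≥0} {p : ℚ≥0} (hpa : p < a) : s p ≤ s a := by
    refine ge_of_tendsto_of_frequently (hlim a) ?_
    refine ((frequently_nnrat_nhdsGT a).and_eventually self_mem_nhdsWithin).mono ?_
    rintro _ ⟨⟨q, rfl⟩, haq⟩
    exact (hs (NNRat.cast_lt.1 (hpa.trans haq))).le
  intro a b hab
  obtain ⟨q, haq, hqb⟩ := exists_nnrat_btwn hab
  obtain ⟨p, hap, hpq⟩ := exists_nnrat_btwn haq
  calc s a ≤ s p := hle hap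
    _ < s q := hs (NNRat.cast_lt.1 hpq)
    _ ≤ s b := hge hqb

/-! ### Strictly increasing subordinators -/

section LaplaceExponent

variable {κ : ℝ} {ν : Measure ℝ}

lemma one_sub_exp_neg_mul_pos {l z : ℝ} (hl : 0 < l) (hz : 0 < z) :
    0 < 1 - Real.exp (-l * z) :=
  sub_pos.2 (Real.exp_lt_one_iff.2 (by nlinarith))

lemma ae_one_sub_exp_neg_mul_nonneg (ν : Measure ℝ) {l : ℝ} (hl : 0 < l) :
    0 ≤ᵐ[ν.restrict (Ioi 0)] fun z => 1 - Real.exp (-l * z) :=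
  (ae_restrict_mem measurableSet_Ioi).mono fun _ hz => (one_sub_exp_neg_mul_pos hl hz).le

lemma IsLevyMeasure.integrableOn (hν : IsLevyMeasure ν) {l : ℝ} (hl : 0 < l) :
    IntegrableOn (fun z => 1 - Real.exp (-l * z)) (Ioi 0) ν := by
  have hmin : IntegrableOn (fun z : ℝ => min 1 z) (Ioi 0) ν := by
    refine ⟨Continuous.aestronglyMeasurable (by fun_prop), ?_⟩
    rw [hasFiniteIntegral_iff_ofReal]
    · exact hν.lintegral_lt_top
    · exact (ae_restrict_mem measurableSet_Ioi).mono fun z hz => le_min zero_le_one (le_of_lt hz)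
  refine (hmin.const_mul (max 1 l)).mono' (Continuous.aestronglyMeasurable (by fun_prop)) ?_
  filter_upwards [ae_restrict_mem measurableSet_Ioi] with z (hz : 0 < z)
  rw [Real.norm_eq_abs, abs_of_pos (one_sub_exp_neg_mul_pos hl hz)]
  rcases min_cases 1 z with ⟨h, _⟩ | ⟨h, _⟩ <;> rw [h]
  · linarith [le_max_left 1 l, Real.exp_pos (-l * z)]
  · calc 1 - Real.exp (-l * z) ≤ l * z := by linarith [Real.add_one_le_exp (-l * z)]
      _ ≤ max 1 l * z := by gcongr; exact le_max_right 1 l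

lemma mul_le_laplaceExponent (κ : ℝ) (ν : Measure ℝ) {l : ℝ} (hl : 0 < l) :
    κ * l ≤ laplaceExponent κ ν l :=
  le_add_of_nonneg_right (integral_nonneg_of_ae (ae_one_sub_exp_neg_mul_nonneg ν hl))

lemma integral_le_laplaceExponent (hκ : 0 ≤ κ) (ν : Measure ℝ) {l : ℝ} (hl : 0 < l) :
    ∫ z in Ioi (0 : ℝ), (1 - Real.exp (-l * z)) ∂ν ≤ laplaceExponent κ ν l :=
  le_add_of_nonneg_left (mul_nonneg hκ hl.le)

lemma laplaceExponent_pos (hκ : 0 ≤ κ) (hν : IsLevyMeasure ν)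
    (hstrict : 0 < κ ∨ ν (Ioi 0) = ∞) {l : ℝ} (hl : 0 < l) : 0 < laplaceExponent κ ν l := by
  rcases hstrict with hκ' | hν'
  · exact (mul_pos hκ' hl).trans_le (mul_le_laplaceExponent κ ν hl)
  · have hsupp : Ioi 0 ⊆ Function.support fun z => 1 - Real.exp (-l * z) :=
      fun z hz => (one_sub_exp_neg_mul_pos hl hz).ne'
    refine lt_of_lt_of_le ?_ (integral_le_laplaceExponent hκ ν hl)
    rw [setIntegral_pos_iff_support_of_nonneg_ae (ae_one_sub_exp_neg_mul_nonneg ν hl)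
      (hν.integrableOn hl), inter_eq_right.2 hsupp, hν']
    exact ENNReal.zero_lt_top

lemma tendsto_lintegral_one_sub_exp (ν : Measure ℝ) :
    Tendsto (fun n : ℕ => ∫⁻ z in Ioi (0 : ℝ),
      ENNReal.ofReal (1 - Real.exp (-(n + 1 : ℝ) * z)) ∂ν) atTop (𝓝 (ν (Ioi 0))) := by
  rw [← setLIntegral_one]
  refine lintegral_tendsto_of_tendsto_of_monotone (fun n => Measurable.aemeasurable (by fun_prop))
    ?_ ?_ <;> filter_upwards [ae_restrict_mem measurableSet_Ioi] with z (hz : 0 < z)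
  · intro m n hmn
    dsimp only
    gcongr
  · have hexp : Tendsto (fun n : ℕ => Real.exp (-(n + 1 : ℝ) * z)) atTop (𝓝 0) := by
      simpa only [Function.comp_def, neg_mul] using Real.tendsto_exp_neg_atTop_nhds_zero.comp
        ((tendsto_atTop_add_const_right _ 1 tendsto_natCast_atTop_atTop).atTop_mul_const hz)
    simpa using ENNReal.tendsto_ofReal (hexp.const_sub 1)

lemma exists_le_laplaceExponent (hκ : 0 ≤ κ) (hν : IsLevyMeasure ν)
    (hstrict : 0 < κ ∨ ν (Ioi 0) = ∞) (M : ℝ) : ∃ l, 0 < l ∧ M ≤ laplaceExponent κ ν l := by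
  rcases hstrict with hκ' | hν'
  · refine ⟨(|M| + 1) / κ, by positivity, ?_⟩
    calc M ≤ |M| + 1 := (le_abs_self M).trans (le_add_of_nonneg_right zero_le_one)
      _ = κ * ((|M| + 1) / κ) := by field_simp
      _ ≤ _ := mul_le_laplaceExponent κ ν (by positivity)
  · have hlim := tendsto_lintegral_one_sub_exp ν
    rw [hν'] at hlim
    obtain ⟨n, hn⟩ := (hlim.eventually (lt_mem_nhds (ENNReal.ofReal_lt_top (r := M)))).exists
    have hl : (0 : ℝ) < n + 1 := by positivity
    rw [← ofReal_integral_eq_lintegral_ofReal (hν.integrableOn hl)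
      (ae_one_sub_exp_neg_mul_nonneg ν hl)] at hn
    exact ⟨n + 1, hl, (lt_imp_lt_of_le_imp_le ENNReal.ofReal_le_ofReal hn).le.trans
      (integral_le_laplaceExponent hκ ν hl)⟩

end LaplaceExponent

section Subordinator

variable {Ω : Type*} [MeasurableSpace Ω] {P : Measure Ω} [IsProbabilityMeasure P] {κ : ℝ}
  {ν : Measure ℝ} {S : ℝ≥0 → Ω → ℝ}

namespace IsSubordinator

lemma integrable_exp (hS : IsSubordinator κ ν S P) {l : ℝ} (hl : 0 < l) (t : ℝ≥0) :
    Integrable (fun ω => Real.exp (-l * S t ω)) P := by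
  refine (integrable_const (1 : ℝ)).mono'
    ((hS.measurable t).const_mul (-l)).exp.aestronglyMeasurable ?_
  filter_upwards [hS.nonneg] with ω hω
  rw [Real.norm_eq_abs, Real.abs_exp]
  exact Real.exp_le_one_iff.2 (by nlinarith [hω t])

lemma measureReal_le_le_exp (hS : IsSubordinator κ ν S P) {l : ℝ} (hl : 0 < l)
    (t : ℝ≥0) (M : ℝ) :
    P.real {ω | S t ω ≤ M} ≤ Real.exp (l * M - t * laplaceExponent κ ν l) := by
  have hmarkov : Real.exp (-l * M) * P.real {ω | Real.exp (-l * M) ≤ Real.exp (-l * S t ω)} ≤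
      Real.exp (-(t : ℝ) * laplaceExponent κ ν l) := by
    rw [← hS.laplace t l hl]
    exact mul_meas_ge_le_integral_of_nonneg (ae_of_all _ fun ω => (Real.exp_pos _).le)
      (hS.integrable_exp hl t) _
  simp only [Real.exp_le_exp, neg_mul, neg_le_neg_iff, mul_le_mul_iff_right₀ hl] at hmarkov
  rwa [sub_eq_add_neg, Real.exp_add, ← div_le_iff₀' (Real.exp_pos _), div_eq_inv_mul,
    ← Real.exp_neg]

lemma ae_pos (hκ : 0 ≤ κ) (hν : IsLevyMeasure ν)
    (hstrict : 0 < κ ∨ ν (Ioi 0) = ∞) (hS : IsSubordinator κ ν S P) {t : ℝ≥0} (ht : 0 < t) :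
    ∀ᵐ ω ∂P, 0 < S t ω := by
  suffices h : P.real {ω | S t ω ≤ 0} = 0 by
    simpa only [ae_iff, not_lt] using (measureReal_eq_zero_iff).1 h
  refine le_antisymm (le_of_forall_pos_le_add fun ε hε => ?_) measureReal_nonneg
  obtain ⟨l, hl, hφ⟩ := exists_le_laplaceExponent hκ hν hstrict (-Real.log ε / t)
  rw [div_le_iff₀' (NNReal.coe_pos.2 ht)] at hφ
  calc P.real {ω | S t ω ≤ 0} ≤ Real.exp (l * 0 - t * laplaceExponent κ ν l) :=
        hS.measureReal_le_le_exp hl t 0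
    _ ≤ Real.exp (Real.log ε) := Real.exp_le_exp.2 (by linarith)
    _ = 0 + ε := by rw [Real.exp_log hε, zero_add]

lemma ae_strictMono_nnratCast (hκ : 0 ≤ κ) (hν : IsLevyMeasure ν)
    (hstrict : 0 < κ ∨ ν (Ioi 0) = ∞) (hS : IsSubordinator κ ν S P) :
    ∀ᵐ ω ∂P, StrictMono fun q : ℚ≥0 => S q ω := by
  simp only [StrictMono, ae_all_iff]
  intro p q hpq
  have hpq' : (p : ℝ≥0) < q := NNRat.cast_lt.2 hpq
  have hinc : ∀ᵐ ω ∂P, 0 < S (p + (q - p)) ω - S p ω :=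
    (hS.stationaryIncrements p (q - p)).symm.ae_snd (p := fun x => 0 < x) measurableSet_Ioi
      (hS.ae_pos hκ hν hstrict (tsub_pos_of_lt hpq'))
  simpa only [add_tsub_cancel_of_le hpq'.le, sub_pos] using hinc

lemma ae_exists_natCast_lt (hS : IsSubordinator κ ν S P) (hφ : 0 < laplaceExponent κ ν 1)
    (M : ℝ) : ∀ᵐ ω ∂P, ∃ n : ℕ, M < S n ω := by
  suffices h : P.real {ω | ∀ n : ℕ, S n ω ≤ M} = 0 by
    simpa only [ae_iff, not_exists, not_lt] using (measureReal_eq_zero_iff).1 h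
  have hlim : Tendsto (fun n : ℕ => Real.exp (1 * M - (n : ℝ≥0) * laplaceExponent κ ν 1))
      atTop (𝓝 0) := by
    refine Real.tendsto_exp_atBot.comp (tendsto_atBot_add_const_left _ _ ?_)
    simpa using tendsto_natCast_atTop_atTop.atTop_mul_const hφ
  refine le_antisymm (ge_of_tendsto' hlim fun n => ?_) measureReal_nonneg
  exact (measureReal_mono fun ω (hω : ∀ m : ℕ, S m ω ≤ M) => hω n).trans
    (hS.measureReal_le_le_exp one_pos n M)

lemma ae_unbounded (hS : IsSubordinator κ ν S P) (hφ : 0 < laplaceExponent κ ν 1) :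
    ∀ᵐ ω ∂P, ∀ M : ℝ, ∃ r, M < S r ω := by
  filter_upwards [ae_all_iff.2 fun m : ℕ => hS.ae_exists_natCast_lt hφ m] with ω hω M
  obtain ⟨m, hm⟩ := exists_nat_gt M
  obtain ⟨n, hn⟩ := hω m
  exact ⟨n, hm.trans hn⟩

lemma ae_isInvertiblePath (hκ : 0 ≤ κ) (hν : IsLevyMeasure ν)
    (hstrict : 0 < κ ∨ ν (Ioi 0) = ∞) (hS : IsSubordinator κ ν S P) :
    ∀ᵐ ω ∂P, IsInvertiblePath fun r => S r ω := by
  filter_upwards [hS.ae_strictMono_nnratCast hκ hν hstrict,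
    hS.ae_unbounded (laplaceExponent_pos hκ hν hstrict one_pos), hS.zero, hS.cadlag]
    with ω hmono hunb hzero hcadlag
  exact ⟨strictMono_of_strictMono_nnratCast hmono fun t => (hcadlag t).1, fun t => (hcadlag t).1,
    hzero, hunb⟩

end IsSubordinator

/-! ### The inverse subordinator at an independent exponential time -/

lemma measurable_ratPathInv_prod (hm : ∀ r, Measurable (S r)) :
    Measurable fun p : Ω × ℝ => ratPathInv p.2 fun r => S r p.1 :=
  measurable_ratPathInv.comp
    (measurable_snd.prodMk ((measurable_pi_lambda _ hm).comp measurable_fst))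

lemma ae_inverseSubordinator_eq {P : Measure Ω}
    (hinv : ∀ᵐ ω ∂P, IsInvertiblePath fun r => S r ω) :
    ∀ᵐ ω ∂P, ∀ t, inverseSubordinator S t ω = ratPathInv t fun r => S r ω := by
  filter_upwards [hinv] with ω hω t
  exact (hω.ratPathInv_eq t).symm

lemma IsInvertiblePath.expMeasure_setOf_lt_pathInv {s : ℝ≥0 → ℝ} (hs : IsInvertiblePath s)
    {l : ℝ} (hl : 0 < l) (x : ℝ≥0) :
    expMeasure l {t | x < pathInv s t} = ENNReal.ofReal (Real.exp (-l * s x)) := by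
  have hnull : expMeasure l {s x} = 0 :=
    withDensity_absolutelyContinuous volume (exponentialPDF l) Real.volume_singleton
  rw [neg_mul, ← expMeasure_Ioi hl (hs.nonneg x)]
  refine le_antisymm ?_ (measure_mono fun t ht => hs.lt_pathInv_of_lt ht)
  calc expMeasure l {t | x < pathInv s t} ≤ expMeasure l (Ici (s x)) :=
        measure_mono fun t ht => le_of_lt_pathInv ht
    _ ≤ expMeasure l {s x} + expMeasure l (Ioi (s x)) := by
        rw [← Ioi_insert, insert_eq]
        exact measure_union_le _ _
    _ = expMeasure l (Ioi (s x)) := by rw [hnull, zero_add]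

lemma ext_of_Ioi_of_ae_nonneg {μ₁ μ₂ : Measure ℝ} [IsProbabilityMeasure μ₁]
    [IsProbabilityMeasure μ₂] (h₁ : ∀ᵐ x ∂μ₁, 0 ≤ x) (h₂ : ∀ᵐ x ∂μ₂, 0 ≤ x)
    (h : ∀ x, 0 ≤ x → μ₁ (Ioi x) = μ₂ (Ioi x)) : μ₁ = μ₂ := by
  have hneg {μ : Measure ℝ} (hμ : ∀ᵐ x ∂μ, 0 ≤ x) {x : ℝ} (hx : x < 0) : μ (Iic x) = 0 :=
    measure_mono_null (fun y hy => not_le.2 (lt_of_le_of_lt hy hx)) hμ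
  refine Measure.ext_of_Iic _ _ fun x => ?_
  rcases lt_or_ge x 0 with hx | hx
  · rw [hneg h₁ hx, hneg h₂ hx]
  · rw [← compl_Ioi, prob_compl_eq_one_sub measurableSet_Ioi,
      prob_compl_eq_one_sub measurableSet_Ioi, h x hx]

lemma IsSubordinator.map_ratPathInv (hS : IsSubordinator κ ν S P)
    (hinv : ∀ᵐ ω ∂P, IsInvertiblePath fun r => S r ω) {l : ℝ} (hl : 0 < l)
    (hφ : 0 < laplaceExponent κ ν l) :
    (P.prod (expMeasure l)).map (fun p => (ratPathInv p.2 fun r => S r p.1 : ℝ)) =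
      expMeasure (laplaceExponent κ ν l) := by
  have := isProbabilityMeasure_expMeasure hl
  have := isProbabilityMeasure_expMeasure hφ
  have hm : Measurable fun p : Ω × ℝ => (ratPathInv p.2 fun r => S r p.1 : ℝ) :=
    (measurable_ratPathInv_prod hS.measurable).coe_nnreal_real
  have := Measure.isProbabilityMeasure_map (μ := P.prod (expMeasure l)) hm.aemeasurable
  refine ext_of_Ioi_of_ae_nonneg
    ((ae_map_iff hm.aemeasurable measurableSet_Ici).2 (ae_of_all _ fun _ => NNReal.coe_nonneg _))
    (ae_nonneg_expMeasure _) fun x hx => ?_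
  lift x to ℝ≥0 using hx
  have htail : ∀ᵐ ω ∂P, expMeasure l (Prod.mk ω ⁻¹'
      ((fun p : Ω × ℝ => (ratPathInv p.2 fun r => S r p.1 : ℝ)) ⁻¹' Ioi (x : ℝ))) =
      ENNReal.ofReal (Real.exp (-l * S x ω)) := by
    filter_upwards [hinv] with ω hω
    rw [← hω.expMeasure_setOf_lt_pathInv hl x]
    congr 1 with t
    simp [hω.ratPathInv_eq]
  rw [Measure.map_apply hm measurableSet_Ioi, Measure.prod_apply (hm measurableSet_Ioi),
    lintegral_congr_ae htail, ← ofReal_integral_eq_lintegral_ofReal (hS.integrable_exp hl x)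
      (ae_of_all _ fun ω => (Real.exp_pos _).le), hS.laplace x l hl,
    expMeasure_Ioi hφ x.coe_nonneg, neg_mul, mul_comm]

end Subordinator

/-! ### Brownian motion at an independent random time -/

section RandomTime

/-- The grid of times `k / (n + 1)`, indexed by `(n, k)`. -/
def gridPoint (i : ℕ × ℕ) : ℝ≥0 := i.2 / (i.1 + 1)

lemma tendsto_gridPoint (r : ℝ≥0) :
    Tendsto (fun n : ℕ => gridPoint (n, ⌊(r : ℝ) * (n + 1)⌋₊)) atTop (𝓝 r) := by
  have hfloor := (tendsto_nat_floor_mul_div_atTop r.coe_nonneg).comp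
    (tendsto_atTop_add_const_right _ 1 tendsto_natCast_atTop_atTop)
  refine NNReal.tendsto_coe.1 (hfloor.congr fun n => ?_)
  simp [gridPoint]

/-- The value at `p.1` of the continuous path whose values on the grid are `p.2`. The `limsup`,
which is a limit for continuous paths, makes the evaluation jointly measurable. -/
def gridEval (p : ℝ≥0 × (ℕ × ℕ → ℝ)) : ℝ :=
  limsup (fun n : ℕ => p.2 (n, ⌊(p.1 : ℝ) * (n + 1)⌋₊)) atTop

lemma measurable_gridEval : Measurable gridEval := by
  refine Measurable.limsup fun n => ?_
  have hcoord : Measurable fun q : ℕ × (ℕ × ℕ → ℝ) => q.2 (n, q.1) :=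
    measurable_from_prod_countable_right fun k => measurable_pi_apply (n, k)
  have hfloor : Measurable fun p : ℝ≥0 × (ℕ × ℕ → ℝ) => ⌊(p.1 : ℝ) * (n + 1)⌋₊ :=
    Nat.measurable_floor.comp (measurable_fst.coe_nnreal_real.mul_const _)
  exact hcoord.comp (hfloor.prodMk measurable_snd)

lemma gridEval_eq {b : ℝ≥0 → ℝ} (hb : Continuous b) (r : ℝ≥0) :
    gridEval (r, fun i => b (gridPoint i)) = b r :=
  ((hb.tendsto r).comp (tendsto_gridPoint r)).limsup_eq

lemma map_prodMk_eq_of_forall_map_eq {α β γ δ : Type*} [MeasurableSpace α] [MeasurableSpace β]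
    [MeasurableSpace γ] [MeasurableSpace δ] (μ : Measure α) {ρ₁ : Measure β} {ρ₂ : Measure γ}
    [SFinite ρ₁] [SFinite ρ₂] {f : α × β → δ} {g : α × γ → δ} (hf : Measurable f)
    (hg : Measurable g)
    (h : ∀ a, ρ₁.map (fun b => f (a, b)) = ρ₂.map fun c => g (a, c)) :
    (μ.prod ρ₁).map (fun p => (p.1, f p)) = (μ.prod ρ₂).map fun p => (p.1, g p) := by
  have hf' : Measurable fun p => (p.1, f p) := measurable_fst.prodMk hf
  have hg' : Measurable fun p => (p.1, g p) := measurable_fst.prodMk hg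
  ext s hs
  rw [Measure.map_apply hf' hs, Measure.map_apply hg' hs, Measure.prod_apply (hf' hs),
    Measure.prod_apply (hg' hs)]
  refine lintegral_congr fun a => ?_
  have hsec : MeasurableSet (Prod.mk a ⁻¹' s) := measurable_prodMk_left hs
  have hfa : Measurable fun b => f (a, b) := hf.comp measurable_prodMk_left
  have hga : Measurable fun c => g (a, c) := hg.comp measurable_prodMk_left
  have hmap := congrArg (fun ρ => ρ (Prod.mk a ⁻¹' s)) (h a)
  rwa [Measure.map_apply hfa hsec, Measure.map_apply hga hsec] at hmap

variable {Ω : Type*} [MeasurableSpace Ω] {P : Measure Ω} {B : ℝ≥0 → Ω → ℝ}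

lemma exists_measurable_gridEval_eq (hB : IsBrownianReal B P) :
    ∃ W : Ω → ℕ × ℕ → ℝ, Measurable W ∧ (∀ᵐ ω ∂P, (fun i => B (gridPoint i) ω) = W ω) ∧
      ∀ᵐ ω ∂P, ∀ r, gridEval (r, W ω) = B r ω := by
  have hW : ∀ᵐ ω ∂P, (fun i => B (gridPoint i) ω) =
      fun i => (hB.aemeasurable (gridPoint i)).mk _ ω := by
    filter_upwards [ae_all_iff.2 fun i => (hB.aemeasurable (gridPoint i)).ae_eq_mk] with ω hω
      using funext hω
  refine ⟨_, measurable_pi_lambda _ fun i => (hB.aemeasurable _).measurable_mk, hW, ?_⟩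
  filter_upwards [hW, hB.cont] with ω hω hcont r
  rw [← hω, gridEval_eq hcont]

lemma map_brownian_eq (hB : IsBrownianReal B P) (r : ℝ≥0) :
    P.map (B r) = (gaussianReal 0 1).map fun z => √(r : ℝ) * z := by
  rw [(hB.hasLaw_eval r).map_eq, gaussianReal_map_const_mul]
  congr 1
  · simp
  · ext
    simp

variable [IsProbabilityMeasure P] {T : Ω → ℝ≥0}

lemma map_prodMk_brownian_eq (hB : IsBrownianReal B P) (hT : Measurable T)
    (hTB : IndepFun T (fun ω r => B r ω) P) :
    AEMeasurable (fun ω => (T ω, B (T ω) ω)) P ∧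
      P.map (fun ω => (T ω, B (T ω) ω)) =
        ((P.map T).prod (gaussianReal 0 1)).map fun p : ℝ≥0 × ℝ => (p.1, √(p.1 : ℝ) * p.2) := by
  obtain ⟨W, hW, hBW, hev⟩ := exists_measurable_gridEval_eq hB
  have hTgrid : IndepFun T (fun ω i => B (gridPoint i) ω) P :=
    hTB.comp (φ := id) (ψ := fun (b : ℝ≥0 → ℝ) (i : ℕ × ℕ) => b (gridPoint i))
      measurable_id (measurable_pi_lambda _ fun i => measurable_pi_apply _)
  have hpair : P.map (fun ω => (T ω, W ω)) = (P.map T).prod (P.map W) :=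
    (indepFun_iff_map_prod_eq_prod_map_map hT.aemeasurable hW.aemeasurable).1
      (hTgrid.congr (ae_eq_refl _) hBW)
  have hm : Measurable fun p : ℝ≥0 × (ℕ × ℕ → ℝ) => (p.1, gridEval p) :=
    measurable_fst.prodMk measurable_gridEval
  have hae : (fun ω => (T ω, B (T ω) ω)) =ᵐ[P] fun ω => (T ω, gridEval (T ω, W ω)) := by
    filter_upwards [hev] with ω hω
    rw [hω]
  have hlaw (r : ℝ≥0) : (P.map W).map (fun w => gridEval (r, w)) =
      (gaussianReal 0 1).map fun z => √(r : ℝ) * z := by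
    have hr : Measurable fun w => gridEval (r, w) :=
      measurable_gridEval.comp measurable_prodMk_left
    rw [Measure.map_map hr hW, ← map_brownian_eq hB]
    exact Measure.map_congr (hev.mono fun ω hω => hω r)
  have := Measure.isProbabilityMeasure_map (μ := P) hW.aemeasurable
  refine ⟨(hm.comp (hT.prodMk hW)).aemeasurable.congr hae.symm, ?_⟩
  calc P.map (fun ω => (T ω, B (T ω) ω))
      = (P.map fun ω => (T ω, W ω)).map fun p => (p.1, gridEval p) := by
        rw [Measure.map_congr hae, Measure.map_map hm (hT.prodMk hW)]
        rfl
    _ = _ := by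
        rw [hpair]
        exact map_prodMk_eq_of_forall_map_eq _ measurable_gridEval (by fun_prop) hlaw

end RandomTime

/-! ### The expected payoff at the inverse subordinator -/

section PayoffValue

variable {Ω : Type*} [MeasurableSpace Ω] {P : Measure Ω} [IsProbabilityMeasure P]
  {S B : ℝ≥0 → Ω → ℝ} {ψ : ℝ → ℝ} {A σ : ℝ}

/-- The function `u(t, x) = E_x[ψ(Y_{L_t})]` for a payoff `ψ`; `callValue` is the case of the call
payoff. -/
def payoffValue (P : Measure Ω) (ψ : ℝ → ℝ) (S B : ℝ≥0 → Ω → ℝ) (σ t x : ℝ) : ℝ :=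
  ∫ ω, ψ (geometricBM σ B x (inverseSubordinator S t ω) ω) ∂P

lemma integrable_and_integral_comp_geometricBM (hψ : Continuous ψ)
    (hA : ∀ x, |ψ x| ≤ A * (1 + |x|)) (hB : IsBrownianReal B P) {T : Ω → ℝ≥0} (hT : Measurable T)
    (hTB : IndepFun T (fun ω r => B r ω) P) (x : ℝ) :
    Integrable (fun ω => ψ (geometricBM σ B x (T ω) ω)) P ∧
      ∫ ω, ψ (geometricBM σ B x (T ω) ω) ∂P = ∫ ω, gbmSemigroup ψ σ (T ω) x ∂P := by
  obtain ⟨hTBm, hlaw⟩ := map_prodMk_brownian_eq hB hT hTB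
  have := Measure.isProbabilityMeasure_map (μ := P) hT.aemeasurable
  set F : ℝ≥0 × ℝ → ℝ := fun p => ψ (x * Real.exp (σ * p.2 - σ ^ 2 / 2 * p.1))
  have hF : Continuous F := hψ.comp (by fun_prop)
  have hscale : Measurable fun p : ℝ≥0 × ℝ => (p.1, √(p.1 : ℝ) * p.2) := by fun_prop
  have hint : Integrable (fun p : ℝ≥0 × ℝ => ψ (x * Real.exp (gbmExponent σ p.1 p.2)))
      ((P.map T).prod (gaussianReal 0 1)) :=
    integrable_comp_mul_exp_gbmExponent hψ hA measurable_coe_nnreal_real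
      (ae_of_all _ fun r => r.coe_nonneg) x
  have hFint : Integrable F (P.map fun ω => (T ω, B (T ω) ω)) := by
    rwa [hlaw, integrable_map_measure hF.aestronglyMeasurable hscale.aemeasurable]
  refine ⟨(integrable_map_measure hF.aestronglyMeasurable hTBm).1 hFint, ?_⟩
  calc ∫ ω, F (T ω, B (T ω) ω) ∂P = ∫ p, F p ∂(P.map fun ω => (T ω, B (T ω) ω)) :=
        (integral_map hTBm hF.aestronglyMeasurable).symm
    _ = ∫ p : ℝ≥0 × ℝ, ψ (x * Real.exp (gbmExponent σ p.1 p.2))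
          ∂((P.map T).prod (gaussianReal 0 1)) := by
        rw [hlaw, integral_map hscale.aemeasurable hF.aestronglyMeasurable]
        rfl
    _ = ∫ r : ℝ≥0, gbmSemigroup ψ σ r x ∂(P.map T) := integral_prod _ hint
    _ = ∫ ω, gbmSemigroup ψ σ (T ω) x ∂P :=
        integral_map hT.aemeasurable hint.integral_prod_left.aestronglyMeasurable

lemma integrable_and_payoffValue_eq (hψ : Continuous ψ) (hA : ∀ x, |ψ x| ≤ A * (1 + |x|))
    (hSm : ∀ r, Measurable (S r)) (hinv : ∀ᵐ ω ∂P, IsInvertiblePath fun r => S r ω)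
    (hB : IsBrownianReal B P) (hSB : IndepFun (fun ω r => S r ω) (fun ω r => B r ω) P) (t x : ℝ) :
    Integrable (fun ω => ψ (geometricBM σ B x (inverseSubordinator S t ω) ω)) P ∧
      payoffValue P ψ S B σ t x =
        ∫ ω, gbmSemigroup ψ σ (ratPathInv t fun r => S r ω) x ∂P := by
  have hrat : Measurable (ratPathInv t) := measurable_ratPathInv.comp measurable_prodMk_left
  obtain ⟨hint, heq⟩ := integrable_and_integral_comp_geometricBM (σ := σ) hψ hA hB
    (hrat.comp (measurable_pi_lambda _ hSm)) (hSB.comp hrat measurable_id) x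
  have hae : (fun ω => ψ (geometricBM σ B x (ratPathInv t fun r => S r ω) ω)) =ᵐ[P]
      fun ω => ψ (geometricBM σ B x (inverseSubordinator S t ω) ω) := by
    filter_upwards [ae_inverseSubordinator_eq hinv] with ω hω
    rw [hω t]
  exact ⟨hint.congr hae, (integral_congr_ae hae).symm.trans heq⟩

variable (hψ : Continuous ψ) (hA : ∀ x, |ψ x| ≤ A * (1 + |x|))
  (hinv : ∀ᵐ ω ∂P, IsInvertiblePath fun r => S r ω) (hB : IsBrownianReal B P)
  (hSB : IndepFun (fun ω r => S r ω) (fun ω r => B r ω) P)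

include hψ hA hinv hB hSB

lemma abs_payoffValue_le (hSm : ∀ r, Measurable (S r)) (t x : ℝ) :
    |payoffValue P ψ S B σ t x| ≤ A * (1 + |x|) := by
  rw [(integrable_and_payoffValue_eq hψ hA hSm hinv hB hSB t x).2]
  simpa using norm_integral_le_of_norm_le_const (μ := P)
    (f := fun ω => gbmSemigroup ψ σ (ratPathInv t fun r => S r ω) x)
    (ae_of_all _ fun ω => abs_gbmSemigroup_le hA (NNReal.coe_nonneg _) x)

lemma continuous_payoffValue (hSm : ∀ r, Measurable (S r)) :
    Continuous fun p : ℝ × ℝ => payoffValue P ψ S B σ p.1 p.2 := by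
  have hA₀ : 0 ≤ A := by simpa using (abs_nonneg _).trans (hA 0)
  simp only [(integrable_and_payoffValue_eq hψ hA hSm hinv hB hSB _ _).2]
  refine continuous_iff_continuousAt.2 fun p => ?_
  refine continuousAt_of_dominated (Eventually.of_forall fun q => ?_) ?_
    (integrable_const (A * (1 + (|p.2| + 1)))) ?_
  · exact (integrable_gbmSemigroup hψ hA ((measurable_ratPathInv.comp measurable_prodMk_left).comp
      (measurable_pi_lambda _ hSm)).coe_nnreal_real
      (ae_of_all _ fun ω => NNReal.coe_nonneg _) _).aestronglyMeasurable
  · filter_upwards [(continuous_snd.abs.tendsto p).eventually_le_const (lt_add_one _)] with q hq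
    refine ae_of_all _ fun ω => (abs_gbmSemigroup_le hA (NNReal.coe_nonneg _) _).trans ?_
    gcongr
  · filter_upwards [hinv] with ω hω
    simp only [hω.ratPathInv_eq]
    exact ((continuous_gbmSemigroup hψ hA σ).comp
      ((NNReal.continuous_coe.comp (hω.continuous_pathInv.comp continuous_fst)).prodMk
        continuous_snd)).continuousAt

lemma payoffValue_zero (hSm : ∀ r, Measurable (S r)) (x : ℝ) :
    payoffValue P ψ S B σ 0 x = ψ x := by
  have hae : ∀ᵐ ω ∂P, gbmSemigroup ψ σ (ratPathInv 0 fun r => S r ω) x = ψ x := by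
    filter_upwards [hinv] with ω hω
    rw [hω.ratPathInv_eq, hω.pathInv_zero, NNReal.coe_zero, gbmSemigroup_zero]
  rw [(integrable_and_payoffValue_eq hψ hA hSm hinv hB hSB 0 x).2, integral_congr_ae hae]
  simp

variable {κ : ℝ} {ν : Measure ℝ} (hS : IsSubordinator κ ν S P)

include hS

lemma timeLaplace_payoffValue_eq {l : ℝ} (hl : 0 < l) (hφ : 0 < laplaceExponent κ ν l) (x : ℝ) :
    timeLaplace (payoffValue P ψ S B σ) l x =
      l⁻¹ * ∫ z, ψ (x * Real.exp z) ∂(gbmExpLaw σ (laplaceExponent κ ν l)) := by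
  have := isProbabilityMeasure_expMeasure hl
  have := isProbabilityMeasure_expMeasure hφ
  have hm := (measurable_ratPathInv_prod hS.measurable).coe_nnreal_real
  have hcont : Continuous fun r => gbmSemigroup ψ σ r x :=
    (continuous_gbmSemigroup hψ hA σ).comp (Continuous.prodMk_left x)
  calc timeLaplace (payoffValue P ψ S B σ) l x
      = l⁻¹ * ∫ t, payoffValue P ψ S B σ t x ∂(expMeasure l) := by
        rw [integral_expMeasure hl, ← integral_const_mul]
        refine integral_congr_ae (ae_of_all _ fun t => ?_)
        simp only [smul_eq_mul, neg_mul]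
        field_simp
    _ = l⁻¹ * ∫ p : Ω × ℝ, gbmSemigroup ψ σ (ratPathInv p.2 fun r => S r p.1) x
          ∂(P.prod (expMeasure l)) := by
        simp only [(integrable_and_payoffValue_eq hψ hA hS.measurable hinv hB hSB _ x).2]
        rw [integral_prod_symm _ (integrable_gbmSemigroup hψ hA hm
          (ae_of_all _ fun p => NNReal.coe_nonneg _) x)]
    _ = l⁻¹ * ∫ r, gbmSemigroup ψ σ r x ∂(expMeasure (laplaceExponent κ ν l)) := by
        rw [← hS.map_ratPathInv hinv hl hφ, integral_map hm.aemeasurable hcont.aestronglyMeasurable]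
    _ = _ := by rw [integral_gbmSemigroup_expMeasure hψ hA hφ]

lemma abs_timeLaplace_payoffValue_le {l : ℝ} (hl : 0 < l) (hφ : 0 < laplaceExponent κ ν l)
    (x : ℝ) : |timeLaplace (payoffValue P ψ S B σ) l x| ≤ l⁻¹ * A * (1 + |x|) := by
  have := isProbabilityMeasure_expMeasure hφ
  have hbound := norm_integral_le_of_norm_le_const (f := fun r => gbmSemigroup ψ σ r x)
    ((ae_nonneg_expMeasure (laplaceExponent κ ν l)).mono fun r hr => abs_gbmSemigroup_le hA hr x)
  rw [probReal_univ, mul_one, Real.norm_eq_abs] at hbound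
  rw [timeLaplace_payoffValue_eq hψ hA hinv hB hSB hS hl hφ,
    ← integral_gbmSemigroup_expMeasure hψ hA hφ, abs_mul, abs_of_pos (inv_pos.2 hl), mul_assoc]
  gcongr

lemma integrableOn_exp_mul_payoffValue {l : ℝ} (hl : 0 < l) (x : ℝ) :
    IntegrableOn (fun t => Real.exp (-l * t) * payoffValue P ψ S B σ t x) (Ioi 0) :=
  Integrable.mul_bdd (integrableOn_exp_mul_Ioi (neg_lt_zero.2 hl) 0)
    ((continuous_payoffValue hψ hA hinv hB hSB hS.measurable).comp
      (Continuous.prodMk_left x)).aestronglyMeasurable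
    (ae_of_all _ fun t => abs_payoffValue_le hψ hA hinv hB hSB hS.measurable t x)

lemma isLaplaceSolution_payoffValue (hφ : ∀ l, 0 < l → 0 < laplaceExponent κ ν l) :
    IsLaplaceSolution κ ν σ ψ (payoffValue P ψ S B σ) := by
  refine ⟨0, le_rfl, fun l hl => ⟨fun x _ =>
    integrableOn_exp_mul_payoffValue hψ hA hinv hB hSB hS hl x,
    ⟨l⁻¹ * A, fun x hx => ?_⟩, ?_⟩⟩
  · simpa only [abs_of_pos hx] using
      abs_timeLaplace_payoffValue_le hψ hA hinv hB hSB hS hl (hφ l hl) x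
  · have := isProbabilityMeasure_gbmExpLaw σ (hφ l hl)
    have hweak := (isWeakSolution_integral_comp_mul_exp (charFun_gbmExpLaw σ (hφ l hl))
      (integrable_exp_gbmExpLaw σ (hφ l hl)) hψ hA).const_mul l⁻¹
    convert hweak using 1
    · ext x
      ring
    · exact funext (timeLaplace_payoffValue_eq hψ hA hinv hB hSB hS hl (hφ l hl))

lemma continuous_timeLaplace_payoffValue {l : ℝ} (hl : 0 < l)
    (hφ : 0 < laplaceExponent κ ν l) :
    Continuous (timeLaplace (payoffValue P ψ S B σ) l) := by
  have := isProbabilityMeasure_gbmExpLaw σ hφ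
  rw [funext (timeLaplace_payoffValue_eq hψ hA hinv hB hSB hS hl hφ)]
  exact (continuous_integral_comp_mul_exp (integrable_exp_gbmExpLaw σ hφ) hψ hA).const_mul l⁻¹

end PayoffValue

/-! ### Comparison of Laplace solutions -/

section Uniqueness

variable {κ σ : ℝ} {ν : Measure ℝ} {ψ : ℝ → ℝ} {u v : ℝ → ℝ → ℝ}

lemma IsLaplaceSolution.exists_forall_ae_timeLaplace_eq (hσ : σ ≠ 0)
    (hφ : ∀ l, 0 < l → 0 < laplaceExponent κ ν l) (hψ : Continuous ψ)
    (hu : IsLaplaceSolution κ ν σ ψ u) (hv : IsLaplaceSolution κ ν σ ψ v) :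
    ∃ l₀ : ℝ, ∀ l, l₀ < l →
      (∀ x, 0 < x → IntegrableOn (fun t => Real.exp (-l * t) * u t x) (Ioi 0)) ∧
      (∀ x, 0 < x → IntegrableOn (fun t => Real.exp (-l * t) * v t x) (Ioi 0)) ∧
      ∀ᵐ x ∂(volume.restrict (Ioi (0 : ℝ))), timeLaplace u l x = timeLaplace v l x := by
  obtain ⟨l₁, hl₁, hu⟩ := hu
  obtain ⟨l₂, -, hv⟩ := hv
  refine ⟨max l₁ l₂, fun l hl => ?_⟩
  obtain ⟨hu_int, ⟨C₁, hu_le⟩, hu_weak⟩ := hu l ((le_max_left _ _).trans_lt hl)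
  obtain ⟨hv_int, ⟨C₂, hv_le⟩, hv_weak⟩ := hv l ((le_max_right _ _).trans_lt hl)
  have hl₀ : 0 < l := hl₁.trans_lt ((le_max_left _ _).trans_lt hl)
  have hg : LocallyIntegrableOn (fun x => laplaceExponent κ ν l / l * ψ x) (Ioi 0) :=
    (hψ.const_mul _).locallyIntegrable.locallyIntegrableOn _
  exact ⟨hu_int, hv_int, hu_weak.ae_eq hσ (hφ l hl₀) hg hv_weak hu_le hv_le⟩

lemma IsLaplaceSolution.ae_ae_eq (hσ : σ ≠ 0) (hφ : ∀ l, 0 < l → 0 < laplaceExponent κ ν l)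
    (hψ : Continuous ψ) (hu : IsLaplaceSolution κ ν σ ψ u) (hv : IsLaplaceSolution κ ν σ ψ v) :
    ∀ᵐ x ∂(volume.restrict (Ioi (0 : ℝ))), ∀ᵐ t ∂(volume.restrict (Ioi (0 : ℝ))),
      u t x = v t x := by
  obtain ⟨l₀, hl₀⟩ := hu.exists_forall_ae_timeLaplace_eq hσ hφ hψ hv
  have hlap : ∀ᵐ x ∂(volume.restrict (Ioi (0 : ℝ))), ∀ n : ℕ, l₀ < n →
      timeLaplace u n x = timeLaplace v n x :=
    ae_all_iff.2 fun n => eventually_imp_distrib_left.2 fun hn => (hl₀ n hn).2.2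
  filter_upwards [hlap, ae_restrict_mem measurableSet_Ioi] with x hx hx₀
  exact ae_eq_of_integral_exp_mul_eq (fun l hl => (hl₀ l hl).1 x hx₀)
    (fun l hl => (hl₀ l hl).2.1 x hx₀) hx

lemma IsLaplaceSolution.ae_eq_of_continuousOn_timeLaplace (hσ : σ ≠ 0)
    (hφ : ∀ l, 0 < l → 0 < laplaceExponent κ ν l) (hψ : Continuous ψ)
    (hu : IsLaplaceSolution κ ν σ ψ u) (hv : IsLaplaceSolution κ ν σ ψ v)
    (hu_cont : ∀ᶠ l in atTop, ContinuousOn (timeLaplace u l) (Ioi 0))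
    (hv_cont : ∀ᶠ l in atTop, ContinuousOn (timeLaplace v l) (Ioi 0)) {x : ℝ} (hx : 0 < x) :
    ∀ᵐ t ∂(volume.restrict (Ioi (0 : ℝ))), u t x = v t x := by
  obtain ⟨l₀, hl₀⟩ := hu.exists_forall_ae_timeLaplace_eq hσ hφ hψ hv
  obtain ⟨l₁, hl₁⟩ := eventually_atTop.1 (hu_cont.and hv_cont)
  refine ae_eq_of_integral_exp_mul_eq (l₀ := max l₀ l₁)
    (fun l hl => (hl₀ l ((le_max_left _ _).trans_lt hl)).1 x hx)
    (fun l hl => (hl₀ l ((le_max_left _ _).trans_lt hl)).2.1 x hx) fun n hn => ?_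
  obtain ⟨hun, hvn⟩ := hl₁ n ((le_max_right _ _).trans hn.le)
  exact Measure.eqOn_open_of_ae_eq (hl₀ n ((le_max_left _ _).trans_lt hn)).2.2 isOpen_Ioi hun hvn hx

lemma eqOn_of_ae_ae_eq (h : ∀ᵐ x ∂(volume.restrict (Ioi (0 : ℝ))),
      ∀ᵐ t ∂(volume.restrict (Ioi (0 : ℝ))), u t x = v t x)
    (hu : ContinuousOn (fun p : ℝ × ℝ => u p.1 p.2) (Ioi 0 ×ˢ Ioi 0))
    (hv : ContinuousOn (fun p : ℝ × ℝ => v p.1 p.2) (Ioi 0 ×ˢ Ioi 0)) {t x : ℝ} (ht : 0 < t)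
    (hx : 0 < x) : u t x = v t x := by
  have hslice_t {y : ℝ} (hy : 0 < y) {f : ℝ → ℝ → ℝ}
      (hf : ContinuousOn (fun p : ℝ × ℝ => f p.1 p.2) (Ioi 0 ×ˢ Ioi 0)) :
      ContinuousOn (fun t => f t y) (Ioi 0) :=
    hf.comp (f := fun t => (t, y)) (by fun_prop) fun _ ht => ⟨ht, hy⟩
  have hslice_x {f : ℝ → ℝ → ℝ}
      (hf : ContinuousOn (fun p : ℝ × ℝ => f p.1 p.2) (Ioi 0 ×ˢ Ioi 0)) :
      ContinuousOn (f t) (Ioi 0) :=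
    hf.comp (f := fun x => (t, x)) (by fun_prop) fun _ hx => ⟨ht, hx⟩
  have hae : ∀ᵐ x ∂(volume.restrict (Ioi (0 : ℝ))), u t x = v t x := by
    filter_upwards [h, ae_restrict_mem measurableSet_Ioi] with y hy hy₀
    exact Measure.eqOn_open_of_ae_eq hy isOpen_Ioi (hslice_t hy₀ hu) (hslice_t hy₀ hv) ht
  exact Measure.eqOn_open_of_ae_eq hae isOpen_Ioi (hslice_x hu) (hslice_x hv) hx

end Uniqueness

lemma continuous_callPayoff (K : ℝ) : Continuous (callPayoff K) :=
  (continuous_sub_right K).max continuous_const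

lemma abs_callPayoff_le (K x : ℝ) : |callPayoff K x| ≤ (1 + |K|) * (1 + |x|) := by
  rw [callPayoff, abs_of_nonneg (le_max_right _ _)]
  refine max_le ?_ (by positivity)
  calc x - K ≤ |x| + |K| := (le_abs_self _).trans (abs_sub x K)
    _ ≤ (1 + |K|) * (1 + |x|) := by nlinarith [abs_nonneg x, abs_nonneg K]

end TimeFractionalBS

end

open TimeFractionalBS in
theorem theorem5p5_general {Ω : Type*} [MeasurableSpace Ω] {P : Measure Ω}
    [IsProbabilityMeasure P] {κ : ℝ} (hκ : 0 ≤ κ) {ν : Measure ℝ} (hν : IsLevyMeasure ν)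
    (hstrict : 0 < κ ∨ ν (Ioi 0) = ∞) {S : ℝ≥0 → Ω → ℝ} (hS : IsSubordinator κ ν S P)
    {B : ℝ≥0 → Ω → ℝ} (hB : IsBrownianReal B P)
    (hSB : IndepFun (fun ω r => S r ω) (fun ω r => B r ω) P)
    {σ : ℝ} (hσ : σ ≠ 0) {ψ : ℝ → ℝ} (hψ : Continuous ψ) {A : ℝ}
    (hA : ∀ x, |ψ x| ≤ A * (1 + |x|)) :
    (∀ t x : ℝ, 0 ≤ t → 0 < x →
      Integrable (fun ω => ψ (geometricBM σ B x (inverseSubordinator S t ω) ω)) P) ∧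
    IsLaplaceSolution κ ν σ ψ (payoffValue P ψ S B σ) ∧
    ContinuousOn (fun p : ℝ × ℝ => payoffValue P ψ S B σ p.1 p.2) (Ici 0 ×ˢ Ioi 0) ∧
    (∀ x : ℝ, 0 < x → payoffValue P ψ S B σ 0 x = ψ x) ∧
    (∀ v : ℝ → ℝ → ℝ, IsLaplaceSolution κ ν σ ψ v →
      (∀ᵐ x ∂(volume.restrict (Ioi (0 : ℝ))), ∀ᵐ t ∂(volume.restrict (Ioi (0 : ℝ))),
        v t x = payoffValue P ψ S B σ t x) ∧
      ((∃ l₁ : ℝ, ∀ l, l₁ < l → ContinuousOn (timeLaplace v l) (Ioi 0)) →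
        ∀ x : ℝ, 0 < x → ∀ᵐ t ∂(volume.restrict (Ioi (0 : ℝ))),
          v t x = payoffValue P ψ S B σ t x) ∧
      (ContinuousOn (fun p : ℝ × ℝ => v p.1 p.2) (Ioi 0 ×ˢ Ioi 0) →
        ∀ t x : ℝ, 0 < t → 0 < x → v t x = payoffValue P ψ S B σ t x)) := by
  have hφ : ∀ l, 0 < l → 0 < laplaceExponent κ ν l := fun l hl =>
    laplaceExponent_pos hκ hν hstrict hl
  have hinv := hS.ae_isInvertiblePath hκ hν hstrict
  have hsol := isLaplaceSolution_payoffValue (σ := σ) hψ hA hinv hB hSB hS hφ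
  have hcont := continuous_payoffValue (σ := σ) hψ hA hinv hB hSB hS.measurable
  refine ⟨fun t x _ _ => (integrable_and_payoffValue_eq hψ hA hS.measurable hinv hB hSB t x).1,
    hsol, hcont.continuousOn,
    fun x _ => payoffValue_zero hψ hA hinv hB hSB hS.measurable x, fun v hv => ?_⟩
  have hae := hv.ae_ae_eq hσ hφ hψ hsol
  refine ⟨hae, fun ⟨l₁, hl₁⟩ x hx => ?_, fun hvc t x ht hx =>
    eqOn_of_ae_ae_eq hae hvc hcont.continuousOn ht hx⟩
  refine hv.ae_eq_of_continuousOn_timeLaplace hσ hφ hψ hsol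
    ((eventually_gt_atTop l₁).mono hl₁) ?_ hx
  filter_upwards [eventually_gt_atTop 0] with l hl
  exact (continuous_timeLaplace_payoffValue hψ hA hinv hB hSB hS hl (hφ l hl)).continuousOn

theorem theorem5p5 {Ω : Type*} [MeasurableSpace Ω] (P : Measure Ω) [IsProbabilityMeasure P]
    (κ : ℝ) (hκ : 0 ≤ κ) (ν : Measure ℝ) (hν : TimeFractionalBS.IsLevyMeasure ν)
    (hstrict : 0 < κ ∨ ν (Ioi 0) = ∞)
    (S : ℝ≥0 → Ω → ℝ) (hS : TimeFractionalBS.IsSubordinator κ ν S P)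
    (B : ℝ≥0 → Ω → ℝ) (hB : IsBrownianReal B P)
    (hSB : IndepFun (fun ω r => S r ω) (fun ω r => B r ω) P)
    (σ : ℝ) (hσ : 0 < σ) (K : ℝ) (hK : 0 < K) :
    -- the expectation defining `u` is finite
    (∀ t x : ℝ, 0 ≤ t → 0 < x →
      Integrable (fun ω => TimeFractionalBS.callPayoff K (TimeFractionalBS.geometricBM σ B x
        (TimeFractionalBS.inverseSubordinator S t ω) ω)) P) ∧
    -- `u` is a solution, continuous up to time `0`, with the right initial value
    TimeFractionalBS.IsLaplaceSolution κ ν σ (TimeFractionalBS.callPayoff K)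
      (TimeFractionalBS.callValue P S B σ K) ∧
    ContinuousOn (fun p : ℝ × ℝ => TimeFractionalBS.callValue P S B σ K p.1 p.2)
      (Ici 0 ×ˢ Ioi 0) ∧
    (∀ x : ℝ, 0 < x →
      TimeFractionalBS.callValue P S B σ K 0 x = TimeFractionalBS.callPayoff K x) ∧
    -- every solution coincides with `u`
    (∀ v : ℝ → ℝ → ℝ,
      TimeFractionalBS.IsLaplaceSolution κ ν σ (TimeFractionalBS.callPayoff K) v →
      (∀ᵐ x ∂(volume.restrict (Ioi (0 : ℝ))), ∀ᵐ t ∂(volume.restrict (Ioi (0 : ℝ))),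
        v t x = TimeFractionalBS.callValue P S B σ K t x) ∧
      ((∃ l₁ : ℝ, ∀ l, l₁ < l → ContinuousOn (TimeFractionalBS.timeLaplace v l) (Ioi 0)) →
        ∀ x : ℝ, 0 < x → ∀ᵐ t ∂(volume.restrict (Ioi (0 : ℝ))),
          v t x = TimeFractionalBS.callValue P S B σ K t x) ∧
      (ContinuousOn (fun p : ℝ × ℝ => v p.1 p.2) (Ioi 0 ×ˢ Ioi 0) →
        ∀ t x : ℝ, 0 < t → 0 < x →
          v t x = TimeFractionalBS.callValue P S B σ K t x)) := by
  exact theorem5p5_general hκ hν hstrict hS hB hSB hσ.ne'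
    (TimeFractionalBS.continuous_callPayoff K) (TimeFractionalBS.abs_callPayoff_le K)
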